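/- Let $\mathbb K$ be a field of characteristic $0$ and $n\ge 0$ an integer. Let $\bar{\mathrm U}(n)$ be the localization of the polynomial ring $\mathbb K[\tilde h_1,\dots,\tilde h_n]$ at the multiplicative set generated by the elements $\tilde h_{ij}+a$, where $\tilde h_{ij}=\tilde h_i-\tilde h_j$, $i\neq j$, $a\in\mathbb Z$. Let $\varepsilon_j$ be the automorphism $\tilde h_i\mapsto\tilde h_i+\delta_{ij}$ of $\bar{\mathrm U}(n)$; for an integral combination $v=\sum_j v_j\varepsilon_j$ write $p[v]$ for the image of $p$ under $\tilde h_i\mapsto\tilde h_i+v_i$, and put $\Delta_jp=p-p[-\varepsilon_j]$. Let $\chi_j=\prod_{k\ne j}\tilde h_{jk}$, and let $\mathcal W\subset\bar{\mathrm U}(n)$ be the sum over $j$ of the spaces $\mathcal W_j=\{\pi(\tilde h_j)/\chi_j : \pi \text{ a univariate polynomial over }\mathbb K\}$. Put $e(t)=\prod_{i=1}^n(1+\tilde h_it)$. Let $\mathrm R^{ij}_{kl}\in\bar{\mathrm U}(n)$ be given by $\mathrm R^{ij}_{ij}=1/\tilde h_{ij}$ for $i\ne j$; $\mathrm R^{ij}_{ji}=(\tilde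 h_{ij}^2-1)/\tilde h_{ij}^2$ for $i<j$; $\mathrm R^{ij}_{ji}=1$ for $i\ge j$; all other components are $0$. Fix $\sigma\in\mathcal W$ and put $\sigma_i=\Delta_i\sigma$. Let $\mathrm{Diff}_{\mathbf h,\sigma}(n)$ be the $\mathbb K$-algebra generated by (the image of) $\bar{\mathrm U}(n)$ and elements $x^i,\bar\partial_i$, $i=1,\dots,n$, with the defining relations $$\tilde h_ix^j=x^j(\tilde h_i+\delta_{ij}),\qquad \tilde h_i\bar\partial_j=\bar\partial_j(\tilde h_i-\delta_{ij}),$$ $$x^ix^j=\sum_{k,l}\mathrm R^{ij}_{kl}x^kx^l,\qquad \bar\partial_l\bar\partial_k=\sum_{i,j}\bar\partial_j\bar\partial_i\mathrm R^{ij}_{kl},\qquad x^i\bar\partial_j=\sum_{k,l}\bar\partial_k\mathrm R^{ki}_{lj}x^l-\delta_{ij}\sigma_i .$$ Let $\rho(t)\in\bar{\mathrm U}(n)[t]$ be a polynomial of degree at most $n-1$ in $t$ (zero if $n=0$) satisfying $$\Delta_j\rho(t)=\frac{e(t)}{1+\tilde h_jt}\,\sigma_j,\qquad j=1,\dots,n,$$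 and let $$c(t)=\sum_{i=1}^n\frac{e(t)}{1+\tilde h_it}\,\bar\partial_ix^i-\rho(t)=\sum_{k=1}^nc_kt^{k-1}$$ be the corresponding polynomial with coefficients in $\mathrm{Diff}_{\mathbf h,\sigma}(n)$. Let $\lambda_1,\dots,\lambda_n\in\mathbb K$ with $\lambda_i-\lambda_j\notin\mathbb Z$ for $i\ne j$. Let $\mathfrak D_n\subset\mathrm{Diff}_{\mathbf h,\sigma}(n)$ be the subring generated by $\bar{\mathrm U}(n)$ and $\bar\partial_1,\dots,\bar\partial_n$, and let $M_{\vec\lambda}$ be the $\mathfrak D_n$-module that is one-dimensional over $\mathbb K$ with basis vector $|\;\rangle$, on which $\tilde h_i|\;\rangle=\lambda_i|\;\rangle$ and $\bar\partial_i|\;\rangle=0$. Then $c(t)$ acts on the induced module $\mathrm{Ind}_{\mathfrak D_n}^{\mathrm{Diff}_{\mathbf h,\sigma}(n)}M_{\vec\lambda}=\mathrm{Diff}_{\mathbf h,\sigma}(n)\otimes_{\mathfrak D_n}M_{\vec\lambda}$ as multiplication by the scalar polynomial $$-\rho(t)[-\varepsilon]\big|_{\tilde h_1=\lambda_1,\dots,\tilde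 h_n=\lambda_n},\qquad \varepsilon=\varepsilon_1+\dots+\varepsilon_n,$$ that is, each coefficient of $c(t)$ acts by the corresponding coefficient of this polynomial. -/

import Mathlib

noncomputable section

namespace HDeformed

open scoped TensorProduct

section Coefficients

variable {K : Type*} [Field K] {n : ℕ}

/-- The multiplicative set generated by the `h i - h j + a`, `i ≠ j`, `a ∈ ℤ`, in the polynomial
ring `U(n) = K[h₁, …, hₙ]`. -/
def denominators (K : Type*) [Field K] (n : ℕ) : Submonoid (MvPolynomial (Fin n) K) :=
  Submonoid.closure {p | ∃ i j : Fin n, i ≠ j ∧ ∃ a : ℤ,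
    p = MvPolynomial.X i - MvPolynomial.X j + (a : MvPolynomial (Fin n) K)}

/-- The ring of fractions `Ū(n)`. -/
abbrev UBar (K : Type*) [Field K] (n : ℕ) : Type _ := Localization (denominators K n)

/-- The generator `h i` of `Ū(n)`. -/
def h (i : Fin n) : UBar K n := algebraMap (MvPolynomial (Fin n) K) (UBar K n) (MvPolynomial.X i)

theorem isUnit_of_mem_denominators {A : Type*} [CommRing A] [Algebra K A] (f : Fin n → A)
    (hf : ∀ i j, i ≠ j → ∀ a : ℤ, IsUnit (f i - f j + (a : A)))
    (y : denominators K n) : IsUnit (MvPolynomial.aeval f (y : MvPolynomial (Fin n) K)) := by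
  obtain ⟨y, hy⟩ := y
  induction hy using Submonoid.closure_induction with
  | mem x hx =>
    obtain ⟨i, j, hij, a, rfl⟩ := hx
    simpa using hf i j hij a
  | one => simp
  | mul x y _ _ hx hy => simpa using hx.mul hy

theorem isUnit_h_sub (i j : Fin n) (hij : i ≠ j) (a : ℤ) :
    IsUnit ((h i : UBar K n) - h j + (a : UBar K n)) := by
  have := IsLocalization.map_units (UBar K n)
    (⟨_, Submonoid.subset_closure ⟨i, j, hij, a, rfl⟩⟩ : denominators K n)
  simpa [h] using this

/-- The translation `p ↦ p[v]`, `v = ∑ vᵢ εᵢ`: the automorphism of `Ū(n)` with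
`h i ↦ h i + v i`. -/
def shift (v : Fin n → ℤ) : UBar K n →ₐ[K] UBar K n :=
  IsLocalization.liftAlgHom (M := denominators K n)
    (f := MvPolynomial.aeval (fun i => (h i : UBar K n) + (v i : UBar K n)))
    (isUnit_of_mem_denominators _ (fun i j hij a => by
      have := isUnit_h_sub (K := K) i j hij (v i - v j + a)
      push_cast at this
      have e : ((h i : UBar K n) + (v i : UBar K n)) - (h j + (v j : UBar K n)) + (a : UBar K n)
          = (h i : UBar K n) - h j + ((v i : UBar K n) - (v j : UBar K n) + (a : UBar K n)) := by
        ring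
      rw [e]; exact this))

/-- The evaluation `Ū(n) → K`, `h i ↦ lam i`, at a point off all the polar hyperplanes. -/
def evalAt (lam : Fin n → K) (hlam : ∀ i j, i ≠ j → ∀ a : ℤ, lam i - lam j ≠ (a : K)) :
    UBar K n →ₐ[K] K :=
  IsLocalization.liftAlgHom (M := denominators K n)
    (f := MvPolynomial.aeval lam)
    (isUnit_of_mem_denominators _ (fun i j hij a => by
      refine isUnit_iff_ne_zero.mpr fun h0 => hlam i j hij (-a) ?_
      push_cast
      linear_combination h0))

/-- The finite-difference operator `Δⱼ f = f - f[-εⱼ]`. -/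
def Delta (j : Fin n) (f : UBar K n) : UBar K n := f - shift (-Pi.single j 1) f

/-- `χᵢ = ∏_{k ≠ i} (h i - h k)`. -/
def chi (i : Fin n) : UBar K n := ∏ k ∈ Finset.univ.erase i, (h i - h k)

/-- The space `𝒲ⱼ` of the elements `π(h j) / χⱼ`, `π` a univariate polynomial.
(`χⱼ` is invertible, so `Ring.inverse` is its inverse.) -/
def WSpace (K : Type*) [Field K] {n : ℕ} (j : Fin n) : Submodule K (UBar K n) :=
  LinearMap.range
    ((LinearMap.mulRight K (Ring.inverse (chi j : UBar K n))).comp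
      (Polynomial.aeval (R := K) (h j : UBar K n)).toLinearMap)

/-- The space `𝒲 = ∑ⱼ 𝒲ⱼ` of potentials. -/
def W (K : Type*) [Field K] (n : ℕ) : Submodule K (UBar K n) := ⨆ j : Fin n, WSpace K j

/-- The component `R^{ij}_{kl}` of the dynamical R-matrix of type A. The differences
`h i - h j`, `i ≠ j`, are invertible, so `Ring.inverse` is the inverse wherever it is used. -/
def RMat (i j k l : Fin n) : UBar K n :=
  if i ≠ j ∧ k = i ∧ l = j then Ring.inverse (h i - h j)
  else if k = j ∧ l = i then
    (if i < j then ((h i - h j) ^ 2 - 1) * Ring.inverse ((h i - h j) ^ 2) else 1)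
  else 0

/-- `e(t) = ∏ᵢ (1 + h i t)`. -/
def ePoly (K : Type*) [Field K] (n : ℕ) : Polynomial (UBar K n) :=
  ∏ i : Fin n, (1 + Polynomial.C (h i) * Polynomial.X)

/-- The polynomial `e(t) / (1 + h i t)`. -/
def eDiv (i : Fin n) : Polynomial (UBar K n) :=
  ∏ k ∈ Finset.univ.erase i, (1 + Polynomial.C (h k) * Polynomial.X)

theorem mul_eDiv (i : Fin n) :
    (1 + Polynomial.C (h i) * Polynomial.X) * eDiv i = ePoly K n :=
  Finset.mul_prod_erase Finset.univ
    (fun k : Fin n => (1 + Polynomial.C (h k : UBar K n) * Polynomial.X)) (Finset.mem_univ i)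

end Coefficients

section Rings

variable {K : Type*} [Field K] {n : ℕ}

/-- Generators of the ring of generalized h-deformed differential operators: the elements of
`Ū(n)`, the coordinates `xⁱ` and the derivatives `∂̄ᵢ`. -/
inductive Gen (K : Type*) [Field K] (n : ℕ) : Type _
  | coef (u : UBar K n)
  | x (i : Fin n)
  | del (i : Fin n)

/-- The element of `Ū(n)`, as an element of the free algebra on the generators. -/
abbrev fcoef (u : UBar K n) : FreeAlgebra K (Gen K n) := FreeAlgebra.ι K (Gen.coef u)
/-- `xⁱ` in the free algebra. -/
abbrev fx (i : Fin n) : FreeAlgebra K (Gen K n) := FreeAlgebra.ι K (Gen.x i)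
/-- `∂̄ᵢ` in the free algebra. -/
abbrev fdel (i : Fin n) : FreeAlgebra K (Gen K n) := FreeAlgebra.ι K (Gen.del i)

/-- The defining relations of `Diff_h(s₁, …, sₙ)`. The first three say that `Ū(n)` is mapped
homomorphically; then come the weights of the generators and the quadratic relations. -/
inductive Rel (s : Fin n → UBar K n) :
    FreeAlgebra K (Gen K n) → FreeAlgebra K (Gen K n) → Prop
  | coef_scalar (r : K) : Rel s (fcoef (algebraMap K (UBar K n) r)) (algebraMap K _ r)
  | coef_add (u v : UBar K n) : Rel s (fcoef (u + v)) (fcoef u + fcoef v)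
  | coef_mul (u v : UBar K n) : Rel s (fcoef (u * v)) (fcoef u * fcoef v)
  | weight_x (i j : Fin n) :
      Rel s (fcoef (h i) * fx j) (fx j * (fcoef (h i) + if i = j then 1 else 0))
  | weight_del (i j : Fin n) :
      Rel s (fcoef (h i) * fdel j) (fdel j * (fcoef (h i) - if i = j then 1 else 0))
  | x_x (i j : Fin n) :
      Rel s (fx i * fx j) (∑ k, ∑ l, fcoef (RMat i j k l) * fx k * fx l)
  | del_del (k l : Fin n) :
      Rel s (fdel l * fdel k) (∑ i, ∑ j, fdel j * fdel i * fcoef (RMat i j k l))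
  | x_del (i j : Fin n) :
      Rel s (fx i * fdel j)
        ((∑ k, ∑ l, fdel k * fcoef (RMat k i l j) * fx l) - if j = i then fcoef (s i) else 0)

/-- The ring `Diff_h(s₁, …, sₙ)`. -/
def DiffRing (s : Fin n → UBar K n) : Type _ := RingQuot (Rel s)

instance (s : Fin n → UBar K n) : Ring (DiffRing s) := inferInstanceAs (Ring (RingQuot (Rel s)))
instance (s : Fin n → UBar K n) : Algebra K (DiffRing s) :=
  inferInstanceAs (Algebra K (RingQuot (Rel s)))

/-- The quotient map from the free algebra. -/
def DiffRing.mk (s : Fin n → UBar K n) : FreeAlgebra K (Gen K n) →ₐ[K] DiffRing s :=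
  RingQuot.mkAlgHom K (Rel s)

theorem DiffRing.mk_rel {s : Fin n → UBar K n} {a b : FreeAlgebra K (Gen K n)} (hab : Rel s a b) :
    DiffRing.mk s a = DiffRing.mk s b :=
  RingQuot.mkAlgHom_rel K hab

/-- The structure map `Ū(n) → Diff_h(s₁, …, sₙ)`. -/
def DiffRing.coef (s : Fin n → UBar K n) : UBar K n →ₐ[K] DiffRing s where
  toFun u := DiffRing.mk s (fcoef u)
  map_one' := by
    have := DiffRing.mk_rel (Rel.coef_scalar (s := s) 1)
    simpa using this
  map_mul' u v := by
    have := DiffRing.mk_rel (Rel.coef_mul (s := s) u v)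
    simpa using this
  map_zero' := by
    have := DiffRing.mk_rel (Rel.coef_scalar (s := s) 0)
    simpa using this
  map_add' u v := by
    have := DiffRing.mk_rel (Rel.coef_add (s := s) u v)
    simpa using this
  commutes' r := by
    have := DiffRing.mk_rel (Rel.coef_scalar (s := s) r)
    simpa using this

/-- The generator `xⁱ`. -/
def DiffRing.x (s : Fin n → UBar K n) (i : Fin n) : DiffRing s := DiffRing.mk s (fx i)

/-- The generator `∂̄ᵢ`. -/
def DiffRing.del (s : Fin n → UBar K n) (i : Fin n) : DiffRing s := DiffRing.mk s (fdel i)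

/-- The ring `Diff_{h,σ}(n)` with potential `σ`. -/
abbrev DiffPot (σ : UBar K n) : Type _ := DiffRing (fun i => Delta i σ)

/-- The polynomial `c(t) = ∑ᵢ e(t)/(1 + h i t) Γᵢ - ρ(t)`, `Γᵢ = ∂̄ᵢ xⁱ`, over `Diff_{h,σ}(n)`
(the variable `t` is central). -/
def cPoly (σ : UBar K n) (ρ : Polynomial (UBar K n)) : Polynomial (DiffPot σ) :=
  (∑ i, (eDiv i).map (DiffRing.coef (fun i => Delta i σ)).toRingHom *
      Polynomial.C (DiffRing.del (fun i => Delta i σ) i * DiffRing.x (fun i => Delta i σ) i))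
    - ρ.map (DiffRing.coef (fun i => Delta i σ)).toRingHom

/-- The `Ū(n)`-subring `𝔇ₙ` of `Diff_{h,σ}(n)` generated by the `∂̄ᵢ`. -/
def DSub (σ : UBar K n) : Subalgebra K (DiffPot σ) :=
  Algebra.adjoin K (Set.range (DiffRing.coef (fun i => Delta i σ)) ∪
    Set.range (DiffRing.del (fun i => Delta i σ)))

/-- The element of `Ū(n)`, as an element of `𝔇ₙ`. -/
def DSub.coef (σ : UBar K n) (u : UBar K n) : DSub σ :=
  ⟨DiffRing.coef _ u, Algebra.subset_adjoin (Or.inl ⟨u, rfl⟩)⟩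

/-- `∂̄ᵢ` as an element of `𝔇ₙ`. -/
def DSub.del (σ : UBar K n) (i : Fin n) : DSub σ :=
  ⟨DiffRing.del _ i, Algebra.subset_adjoin (Or.inr ⟨i, rfl⟩)⟩

end Rings

section Character

variable {K : Type*} [Field K] {n : ℕ}

@[simp] theorem evalAt_h (lam : Fin n → K)
    (hlam : ∀ i j, i ≠ j → ∀ a : ℤ, lam i - lam j ≠ (a : K)) (i : Fin n) :
    evalAt lam hlam (h i) = lam i := by
  simp [evalAt, h]

@[simp] theorem shift_h (v : Fin n → ℤ) (i : Fin n) :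
    shift v (h i : UBar K n) = h i + (v i : UBar K n) := by
  simp [shift, h]

theorem uBar_hom_ext {A : Type*} [CommRing A] [Algebra K A] {f g : UBar K n →ₐ[K] A}
    (hfg : ∀ i, f (h i) = g (h i)) : f = g := by
  apply IsLocalization.algHom_ext (denominators K n)
  apply MvPolynomial.algHom_ext
  intro i
  exact hfg i

/-- The hypothesis on a weight is stable under integral translations. -/
theorem generic_add {lam : Fin n → K}
    (hlam : ∀ i j, i ≠ j → ∀ a : ℤ, lam i - lam j ≠ (a : K)) (m : Fin n → ℤ) :
    ∀ i j, i ≠ j → ∀ a : ℤ, (lam i + m i) - (lam j + m j) ≠ (a : K) := by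
  intro i j hij a h0
  refine hlam i j hij (a - m i + m j) ?_
  push_cast
  linear_combination h0

theorem evalAt_shift (lam mu : Fin n → K)
    (hlam : ∀ i j, i ≠ j → ∀ a : ℤ, lam i - lam j ≠ (a : K))
    (hmu : ∀ i j, i ≠ j → ∀ a : ℤ, mu i - mu j ≠ (a : K)) (v : Fin n → ℤ)
    (hv : ∀ i, mu i = lam i + v i) (u : UBar K n) :
    evalAt lam hlam (shift v u) = evalAt mu hmu u := by
  have : (evalAt lam hlam).comp (shift v) = evalAt mu hmu := by
    apply uBar_hom_ext
    intro i
    simp [hv]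
  exact DFunLike.congr_fun this u

theorem map_inverse_of_isUnit {A : Type*} [CommRing A] {F : Type*} [Field F] (f : A →+* F) {u : A}
    (hu : IsUnit u) : f (Ring.inverse u) = (f u)⁻¹ := by
  apply eq_inv_of_mul_eq_one_left
  rw [← map_mul, Ring.inverse_mul_cancel _ hu, map_one]

theorem isUnit_h_sub' (i j : Fin n) (hij : i ≠ j) : IsUnit ((h i : UBar K n) - h j) := by
  simpa using isUnit_h_sub (K := K) i j hij 0

theorem evalAt_RMat (lam : Fin n → K)
    (hlam : ∀ i j, i ≠ j → ∀ a : ℤ, lam i - lam j ≠ (a : K)) (i j k l : Fin n) :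
    evalAt lam hlam (RMat i j k l) =
      if i ≠ j ∧ k = i ∧ l = j then (lam i - lam j)⁻¹
      else if k = j ∧ l = i then
        (if i < j then ((lam i - lam j) ^ 2 - 1) / (lam i - lam j) ^ 2 else 1)
      else 0 := by
  unfold RMat
  split_ifs with h1 h2 h3
  · have := map_inverse_of_isUnit (evalAt lam hlam).toRingHom (isUnit_h_sub' i j h1.1)
    simpa using this
  · have := map_inverse_of_isUnit (evalAt lam hlam).toRingHom
      ((isUnit_h_sub' (K := K) i j h3.ne).pow 2)
    simp only [AlgHom.toRingHom_eq_coe, RingHom.coe_coe, map_pow, map_sub, evalAt_h] at this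
    simp [this, div_eq_mul_inv]
  · simp
  · simp

theorem evalAt_inv_chi (lam : Fin n → K)
    (hlam : ∀ i j, i ≠ j → ∀ a : ℤ, lam i - lam j ≠ (a : K)) (i : Fin n) :
    evalAt lam hlam (Ring.inverse (chi i)) =
      ∏ k ∈ Finset.univ.erase i, (lam i - lam k)⁻¹ := by
  have hu : IsUnit (chi i : UBar K n) := by
    unfold chi
    rw [IsUnit.prod_iff]
    intro k hk
    exact isUnit_h_sub' i k (Finset.ne_of_mem_erase hk).symm
  have := map_inverse_of_isUnit (evalAt lam hlam).toRingHom hu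
  simpa [chi, Finset.prod_inv_distrib] using this

theorem exists_of_mem_W {σ : UBar K n} (hσ : σ ∈ W K n) :
    ∃ A : Fin n → Polynomial K,
      σ = ∑ j, Polynomial.aeval (h j : UBar K n) (A j) * Ring.inverse (chi j) := by
  rw [W, Submodule.mem_iSup_iff_exists_finsupp] at hσ
  obtain ⟨f, hf, rfl⟩ := hσ
  choose A hA using hf
  refine ⟨A, ?_⟩
  rw [Finsupp.sum_fintype _ _ (fun _ => rfl)]
  refine Finset.sum_congr rfl fun j _ => ?_
  rw [← hA j]
  rfl

/-- The coefficients of an auxiliary action on functions on a lattice of weights. -/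
def auxA (i : Fin n) (z : Fin n → K) : K := ∏ k ∈ Finset.Iio i, (z i - z k - 1)⁻¹
/-- See `auxA`. -/
def auxB (A : Fin n → Polynomial K) (i : Fin n) (z : Fin n → K) : K :=
  (A i).eval (z i) * ∏ k ∈ Finset.Ioi i, (z i - z k)⁻¹

theorem prod_change {ι F : Type*} [DecidableEq ι] [Field F] (S : Finset ι) (i : ι) (hi : i ∈ S)
    (f g : ι → F) (hfg : ∀ k ∈ S, k ≠ i → f k = g k) (hg : g i ≠ 0) :
    ∏ k ∈ S, f k = (∏ k ∈ S, g k) * (f i / g i) := by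
  rw [← Finset.mul_prod_erase S f hi, ← Finset.mul_prod_erase S g hi]
  rw [Finset.prod_congr rfl (fun k hk => hfg k (Finset.mem_of_mem_erase hk)
    (Finset.ne_of_mem_erase hk))]
  field_simp

theorem auxA_of_le {i j : Fin n} (hij : i < j) {z z' : Fin n → K}
    (hz : ∀ k, k ≠ j → z' k = z k) : auxA i z' = auxA i z := by
  unfold auxA
  refine Finset.prod_congr rfl fun k hk => ?_
  rw [hz i hij.ne, hz k ((Finset.mem_Iio.mp hk).trans hij).ne]

theorem auxB_of_lt {A : Fin n → Polynomial K} {i j : Fin n} (hij : j < i) {z z' : Fin n → K}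
    (hz : ∀ k, k ≠ j → z' k = z k) : auxB A i z' = auxB A i z := by
  unfold auxB
  rw [hz i hij.ne']
  congr 1
  refine Finset.prod_congr rfl fun k hk => ?_
  rw [hz k (hij.trans (Finset.mem_Ioi.mp hk)).ne']

theorem auxA_of_gt {i j : Fin n} (hij : j < i) {z z' : Fin n → K}
    (hz : ∀ k, k ≠ j → z' k = z k) (h0 : z i - z j - 1 ≠ 0) :
    auxA i z' = auxA i z * ((z i - z j - 1) / (z i - z' j - 1)) := by
  unfold auxA
  rw [prod_change (Finset.Iio i) j (Finset.mem_Iio.mpr hij) (fun k => (z' i - z' k - 1)⁻¹)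
    (fun k => (z i - z k - 1)⁻¹) _ (inv_ne_zero h0)]
  · simp only [hz i hij.ne', div_eq_mul_inv, inv_inv]
    ring
  · intro k _ hk
    simp only [hz i hij.ne', hz k hk]

theorem auxB_of_gt {A : Fin n → Polynomial K} {i j : Fin n} (hij : i < j) {z z' : Fin n → K}
    (hz : ∀ k, k ≠ j → z' k = z k) (h0 : z i - z j ≠ 0) :
    auxB A i z' = auxB A i z * ((z i - z j) / (z i - z' j)) := by
  unfold auxB
  rw [prod_change (Finset.Ioi i) j (Finset.mem_Ioi.mpr hij) (fun k => (z' i - z' k)⁻¹)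
    (fun k => (z i - z k)⁻¹) _ (inv_ne_zero h0)]
  · simp only [hz i hij.ne, div_eq_mul_inv, inv_inv]
    ring
  · intro k _ hk
    simp only [hz i hij.ne, hz k hk]

theorem auxB_mul_auxA {A : Fin n → Polynomial K} (i : Fin n) {z z' : Fin n → K}
    (hz : ∀ k, k ≠ i → z' k = z k) (hi : z' i = z i + 1) :
    auxB A i z * auxA i z' = (A i).eval (z i) * ∏ k ∈ Finset.univ.erase i, (z i - z k)⁻¹ := by
  have e : (Finset.univ.erase i : Finset (Fin n)) = Finset.Ioi i ∪ Finset.Iio i := by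
    ext k
    simp only [Finset.mem_erase, Finset.mem_univ, Finset.mem_union, Finset.mem_Ioi, Finset.mem_Iio,
      and_true]
    exact ⟨fun hk => (lt_or_gt_of_ne hk).symm, fun hk => hk.elim ne_of_gt ne_of_lt⟩
  have hd : Disjoint (Finset.Ioi i) (Finset.Iio i) := by
    rw [Finset.disjoint_left]
    intro k hk hk'
    exact lt_asymm (Finset.mem_Ioi.mp hk) (Finset.mem_Iio.mp hk')
  rw [e, Finset.prod_union hd]
  unfold auxA auxB
  have : ∏ k ∈ Finset.Iio i, (z' i - z' k - 1)⁻¹ = ∏ k ∈ Finset.Iio i, (z i - z k)⁻¹ := by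
    refine Finset.prod_congr rfl fun k hk => ?_
    rw [hi, hz k (Finset.mem_Iio.mp hk).ne]
    ring_nf
  rw [this]
  ring

theorem sum_RMat (lam : Fin n → K)
    (hlam : ∀ i j, i ≠ j → ∀ a : ℤ, lam i - lam j ≠ (a : K)) (i j : Fin n)
    (F : Fin n → Fin n → K) :
    ∑ k, ∑ l, evalAt lam hlam (RMat i j k l) * F k l =
      if i = j then F i i else (lam i - lam j)⁻¹ * F i j +
        (if i < j then ((lam i - lam j) ^ 2 - 1) / (lam i - lam j) ^ 2 else 1) * F j i := by
  have e : ∀ k l, evalAt lam hlam (RMat i j k l) * F k l =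
      (if k = i then (if l = j then (if i = j then 0 else (lam i - lam j)⁻¹ * F i j) else 0)
        else 0) +
      (if k = j then (if l = i then
        (if i < j then ((lam i - lam j) ^ 2 - 1) / (lam i - lam j) ^ 2 else 1) * F j i else 0)
        else 0) := by
    intro k l
    rw [evalAt_RMat]
    by_cases hij : i = j
    · subst hij
      by_cases hk : k = i
      · subst hk
        by_cases hl : l = k
        · subst hl; simp
        · simp [hl]
      · simp [hk]
    · by_cases hk : k = i
      · subst hk
        by_cases hl : l = j
        · subst hl; simp [hij]
        · simp [hij, hl]
      · by_cases hk' : k = j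
        · subst hk'
          by_cases hl : l = i
          · subst hl; simp [hij, hk]
          · simp [hl, hk]
        · simp [hk, hk']
  simp only [e, Finset.sum_add_distrib, Finset.sum_ite_irrel, Finset.sum_const_zero,
    Finset.sum_ite_eq', Finset.mem_univ, if_true]
  by_cases hij : i = j
  · subst hij; simp
  · simp [hij]

/-- The weight `lam + m`. -/
def wt (lam : Fin n → K) (m : Fin n → ℤ) : Fin n → K := fun i => lam i + m i

theorem wt_ne {lam : Fin n → K}
    (hlam : ∀ i j, i ≠ j → ∀ a : ℤ, lam i - lam j ≠ (a : K)) (m : Fin n → ℤ) :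
    ∀ i j, i ≠ j → ∀ a : ℤ, wt lam m i - wt lam m j ≠ (a : K) := generic_add hlam m

/-- Auxiliary action on functions on the weight lattice: `Ū(n)` acts by evaluation. -/
def opCoef (lam : Fin n → K) (hlam : ∀ i j, i ≠ j → ∀ a : ℤ, lam i - lam j ≠ (a : K))
    (u : UBar K n) : Module.End K ((Fin n → ℤ) → K) where
  toFun f m := evalAt (wt lam m) (wt_ne hlam m) u * f m
  map_add' f g := by ext m; simp [mul_add]
  map_smul' r f := by ext m; simp; ring

/-- Auxiliary action of `xⁱ`. -/
def opX (lam : Fin n → K) (i : Fin n) : Module.End K ((Fin n → ℤ) → K) where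
  toFun f m := auxA i (wt lam m) * f (m - Pi.single i 1)
  map_add' f g := by ext m; simp [mul_add]
  map_smul' r f := by ext m; simp; ring

/-- Auxiliary action of `∂̄ᵢ`. -/
def opDel (A : Fin n → Polynomial K) (lam : Fin n → K) (i : Fin n) :
    Module.End K ((Fin n → ℤ) → K) where
  toFun f m := auxB A i (wt lam m) * f (m + Pi.single i 1)
  map_add' f g := by ext m; simp [mul_add]
  map_smul' r f := by ext m; simp; ring

/-- The auxiliary action on the free algebra. -/
def opFree (A : Fin n → Polynomial K) (lam : Fin n → K)
    (hlam : ∀ i j, i ≠ j → ∀ a : ℤ, lam i - lam j ≠ (a : K)) :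
    FreeAlgebra K (Gen K n) →ₐ[K] Module.End K ((Fin n → ℤ) → K) :=
  FreeAlgebra.lift K fun g => match g with
    | Gen.coef u => opCoef lam hlam u
    | Gen.x i => opX lam i
    | Gen.del i => opDel A lam i

theorem wt_add_ne (lam : Fin n → K) (m : Fin n → ℤ) (i : Fin n) (c : ℤ) (k : Fin n) (hk : k ≠ i) :
    wt lam (m + Pi.single i c) k = wt lam m k := by
  simp [wt, hk]

theorem wt_sub_ne (lam : Fin n → K) (m : Fin n → ℤ) (i : Fin n) (c : ℤ) (k : Fin n) (hk : k ≠ i) :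
    wt lam (m - Pi.single i c) k = wt lam m k := by
  simp [wt, hk]

theorem wt_add_self (lam : Fin n → K) (m : Fin n → ℤ) (i : Fin n) :
    wt lam (m + Pi.single i 1) i = wt lam m i + 1 := by
  simp [wt, add_assoc]

theorem wt_sub_self (lam : Fin n → K) (m : Fin n → ℤ) (i : Fin n) :
    wt lam (m - Pi.single i 1) i = wt lam m i - 1 := by
  simp [wt]; ring

theorem opFree_x_x_aux (lam : Fin n → K)
    (hlam : ∀ i j, i ≠ j → ∀ a : ℤ, lam i - lam j ≠ (a : K)) (m : Fin n → ℤ) {i j : Fin n}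
    (hij : i < j) :
    auxA i (wt lam m) * auxA j (wt lam (m - Pi.single i 1)) =
      (wt lam m i - wt lam m j + 1) / (wt lam m i - wt lam m j) *
      (auxA j (wt lam m) * auxA i (wt lam (m - Pi.single j 1))) := by
  have g := wt_ne hlam m
  have g0 := g i j hij.ne 0
  have g1 := g j i hij.ne' 1
  simp only [Int.cast_zero, Int.cast_one] at g0 g1
  rw [auxA_of_le hij (wt_sub_ne lam m j 1), auxA_of_gt hij (wt_sub_ne lam m i 1)
    (sub_ne_zero.mpr g1), wt_sub_self]
  have : wt lam m j - (wt lam m i - 1) - 1 = -(wt lam m i - wt lam m j) := by ring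
  rw [this]
  field_simp
  ring

theorem opFree_del_del_aux (A : Fin n → Polynomial K) (lam : Fin n → K)
    (hlam : ∀ i j, i ≠ j → ∀ a : ℤ, lam i - lam j ≠ (a : K)) (m : Fin n → ℤ) {i j : Fin n}
    (hij : i < j) :
    auxB A i (wt lam m) * auxB A j (wt lam (m + Pi.single i 1)) =
      (wt lam m i - wt lam m j - 1) / (wt lam m i - wt lam m j) *
      (auxB A j (wt lam m) * auxB A i (wt lam (m + Pi.single j 1))) := by
  have g := wt_ne hlam m
  have g0 := g i j hij.ne 0
  have g1 := g i j hij.ne 1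
  simp only [Int.cast_zero, Int.cast_one] at g0 g1
  rw [auxB_of_lt hij (wt_add_ne lam m i 1), auxB_of_gt hij (wt_add_ne lam m j 1) g0, wt_add_self]
  have h1 : wt lam m i - (wt lam m j + 1) = wt lam m i - wt lam m j - 1 := by ring
  have h2 : wt lam m i - wt lam m j - 1 ≠ 0 := sub_ne_zero.mpr g1
  rw [h1]
  field_simp

/-- The values of `Γ k` in the auxiliary action. -/
theorem auxSigma_shift (A : Fin n → Polynomial K) (lam : Fin n → K)
    (hlam : ∀ i j, i ≠ j → ∀ a : ℤ, lam i - lam j ≠ (a : K)) (m : Fin n → ℤ) (i k : Fin n)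
    (hk : k ≠ i) :
    (A k).eval (wt lam (m - Pi.single i 1) k) * ∏ l ∈ Finset.univ.erase k,
        (wt lam (m - Pi.single i 1) k - wt lam (m - Pi.single i 1) l)⁻¹ =
    (A k).eval (wt lam m k) * (∏ l ∈ Finset.univ.erase k, (wt lam m k - wt lam m l)⁻¹) *
      ((wt lam m k - wt lam m i) / (wt lam m k - wt lam m i + 1)) := by
  have g0 := wt_ne hlam m k i hk 0
  simp only [Int.cast_zero] at g0
  rw [wt_sub_ne lam m i 1 k hk, mul_assoc]
  congr 1
  refine (prod_change (Finset.univ.erase k) i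
    (Finset.mem_erase.mpr ⟨hk.symm, Finset.mem_univ _⟩)
    (fun l => (wt lam m k - wt lam (m - Pi.single i 1) l)⁻¹)
    (fun l => (wt lam m k - wt lam m l)⁻¹) ?_ (inv_ne_zero g0)).trans ?_
  rotate_left
  · simp only [wt_sub_self, div_eq_mul_inv, inv_inv]
    have : wt lam m k - (wt lam m i - 1) = wt lam m k - wt lam m i + 1 := by ring
    rw [this]
    ring
  · intro l _ hl
    simp only [wt_sub_ne lam m i 1 l hl]

theorem evalAt_potential (A : Fin n → Polynomial K) (mu : Fin n → K)
    (hmu : ∀ i j, i ≠ j → ∀ a : ℤ, mu i - mu j ≠ (a : K)) :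
    evalAt mu hmu (∑ j, Polynomial.aeval (h j : UBar K n) (A j) * Ring.inverse (chi j)) =
      ∑ j, (A j).eval (mu j) * ∏ l ∈ Finset.univ.erase j, (mu j - mu l)⁻¹ := by
  rw [map_sum]
  refine Finset.sum_congr rfl fun j _ => ?_
  rw [map_mul, evalAt_inv_chi, ← Polynomial.aeval_algHom_apply, evalAt_h,
    Polynomial.coe_aeval_eq_eval]

theorem opFree_x_del_self (A : Fin n → Polynomial K) (lam : Fin n → K)
    (hlam : ∀ i j, i ≠ j → ∀ a : ℤ, lam i - lam j ≠ (a : K)) (m : Fin n → ℤ) (i : Fin n) :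
    auxA i (wt lam m) * auxB A i (wt lam (m - Pi.single i 1)) =
      (∑ k, auxB A k (wt lam m) * ((if k = i then 1 else (wt lam m k + 1 - wt lam m i)⁻¹) *
        auxA k (wt lam (m + Pi.single k 1)))) -
      evalAt (wt lam m) (wt_ne hlam m) (Delta i
        (∑ j, Polynomial.aeval (h j : UBar K n) (A j) * Ring.inverse (chi j))) := by
  have hself := auxB_mul_auxA (A := A) i (z := wt lam (m - Pi.single i 1)) (z' := wt lam m)
    (fun k hk => (wt_sub_ne lam m i 1 k hk).symm) (by rw [wt_sub_self]; ring)
  rw [mul_comm, hself, Delta, map_sub,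
    evalAt_shift (wt lam m) (wt lam (m - Pi.single i 1)) (wt_ne hlam m) (wt_ne hlam _) _
      (by intro k; simp [wt]; ring),
    evalAt_potential, evalAt_potential]
  have hsum : ∑ k, auxB A k (wt lam m) *
      ((if k = i then 1 else (wt lam m k + 1 - wt lam m i)⁻¹) *
        auxA k (wt lam (m + Pi.single k 1))) =
      ∑ k, (if k = i then 1 else (wt lam m k + 1 - wt lam m i)⁻¹) *
        ((A k).eval (wt lam m k) * ∏ l ∈ Finset.univ.erase k, (wt lam m k - wt lam m l)⁻¹) := by
    refine Finset.sum_congr rfl fun k _ => ?_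
    rw [← auxB_mul_auxA (A := A) k (z := wt lam m) (z' := wt lam (m + Pi.single k 1))
      (fun l hl => wt_add_ne lam m k 1 l hl) (wt_add_self lam m k)]
    ring
  rw [hsum]
  have hsh := auxSigma_shift A lam hlam m i
  generalize ht : (fun k => (A k).eval (wt lam m k) *
    ∏ l ∈ Finset.univ.erase k, (wt lam m k - wt lam m l)⁻¹) = t at hsh
  generalize ht' : (fun k => (A k).eval (wt lam (m - Pi.single i 1) k) *
    ∏ l ∈ Finset.univ.erase k,
      (wt lam (m - Pi.single i 1) k - wt lam (m - Pi.single i 1) l)⁻¹) = t' at hsh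
  have e : ∀ k, (A k).eval (wt lam m k) *
    ∏ l ∈ Finset.univ.erase k, (wt lam m k - wt lam m l)⁻¹ = t k := congrFun ht
  have e' : ∀ k, (A k).eval (wt lam (m - Pi.single i 1) k) *
    ∏ l ∈ Finset.univ.erase k,
      (wt lam (m - Pi.single i 1) k - wt lam (m - Pi.single i 1) l)⁻¹ = t' k := congrFun ht'
  simp only [e, e'] at hsh ⊢
  rw [← Finset.sum_sub_distrib, ← Finset.sum_sub_distrib, Finset.sum_eq_single i]
  · simp
  · intro k _ hk
    have g1 := wt_ne hlam m k i hk (-1)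
    have h1 : wt lam m k - wt lam m i + 1 ≠ 0 := fun h0 => g1 (by
      push_cast
      linear_combination h0)
    have h2 : wt lam m k + 1 - wt lam m i = wt lam m k - wt lam m i + 1 := by ring
    rw [if_neg hk, hsh k hk, h2]
    field_simp
    ring
  · simp

theorem opFree_rel (A : Fin n → Polynomial K) (lam : Fin n → K)
    (hlam : ∀ i j, i ≠ j → ∀ a : ℤ, lam i - lam j ≠ (a : K))
    {p q : FreeAlgebra K (Gen K n)}
    (hpq : Rel (fun i => Delta i
      (∑ j, Polynomial.aeval (h j : UBar K n) (A j) * Ring.inverse (chi j))) p q) :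
    opFree A lam hlam p = opFree A lam hlam q := by
  cases hpq with
  | coef_scalar r =>
    ext f m
    simp [opFree, opCoef]
  | coef_add u v =>
    ext f m
    simp [opFree, opCoef, add_mul]
  | coef_mul u v =>
    ext f m
    simp [opFree, opCoef, mul_assoc]
  | weight_x i j =>
    ext f m
    by_cases hij : i = j
    · subst hij
      simp [opFree, opCoef, opX, wt_sub_self]
      ring
    · simp [opFree, opCoef, opX, wt_sub_ne _ _ _ _ _ hij, hij]
      ring
  | weight_del i j =>
    ext f m
    by_cases hij : i = j
    · subst hij
      simp [opFree, opCoef, opDel, wt_add_self]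
      ring
    · simp [opFree, opCoef, opDel, wt_add_ne _ _ _ _ _ hij, hij]
      ring
  | x_x i j =>
    ext f m
    have hs := sum_RMat (wt lam m) (wt_ne hlam m) i j (fun k l => auxA k (wt lam m) *
      (auxA l (wt lam (m - Pi.single k 1)) * f (m - Pi.single k 1 - Pi.single l 1)))
    simp only [opFree, map_mul, map_sum, FreeAlgebra.lift_ι_apply, LinearMap.sum_apply,
      Module.End.mul_apply, opX, opCoef, LinearMap.coe_mk, AddHom.coe_mk, Finset.sum_apply]
    rw [hs]
    rcases lt_trichotomy i j with hij | rfl | hij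
    · have key := opFree_x_x_aux lam hlam m hij
      have g0 := wt_ne hlam m i j hij.ne 0
      simp only [Int.cast_zero] at g0
      rw [if_neg hij.ne, if_pos hij, sub_right_comm m (Pi.single j 1)]
      generalize f (m - Pi.single i 1 - Pi.single j 1) = F
      rw [← mul_assoc, ← mul_assoc, key]
      field_simp
      ring
    · simp
    · have key := opFree_x_x_aux lam hlam m hij
      have g0 := wt_ne hlam m j i hij.ne 0
      simp only [Int.cast_zero] at g0
      rw [if_neg hij.ne', if_neg hij.le.not_gt, sub_right_comm m (Pi.single j 1)]
      generalize f (m - Pi.single i 1 - Pi.single j 1) = F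
      have h2 : wt lam m i - wt lam m j = -(wt lam m j - wt lam m i) := by ring
      rw [← mul_assoc (auxA j (wt lam m)), key, h2]
      field_simp
      ring
  | del_del k l =>
    ext f m
    simp only [opFree, map_mul, map_sum, FreeAlgebra.lift_ι_apply, LinearMap.sum_apply,
      Module.End.mul_apply, opDel, opCoef, LinearMap.coe_mk, AddHom.coe_mk, Finset.sum_apply]
    have e : ∀ x c, auxB A c (wt lam m) * (auxB A x (wt lam (m + Pi.single c 1)) *
        ((evalAt (wt lam (m + Pi.single c 1 + Pi.single x 1)) (wt_ne hlam _)) (RMat x c k l) *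
              f (m + Pi.single c 1 + Pi.single x 1))) =
        (if x = k then (if c = l then (if k = l then 0 else (wt lam m k - wt lam m l)⁻¹ *
          (auxB A l (wt lam m) * auxB A k (wt lam (m + Pi.single l 1)) *
            f (m + Pi.single l 1 + Pi.single k 1))) else 0) else 0) +
        (if x = l then (if c = k then (if l < k then
          ((wt lam m l - wt lam m k) ^ 2 - 1) / (wt lam m l - wt lam m k) ^ 2 else 1) *
          (auxB A k (wt lam m) * auxB A l (wt lam (m + Pi.single k 1)) *
            f (m + Pi.single l 1 + Pi.single k 1)) else 0) else 0) := by
      intro x c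
      rw [evalAt_RMat]
      by_cases h1 : k = x ∧ l = c
      · obtain ⟨rfl, rfl⟩ := h1
        by_cases hkl : k = l
        · subst hkl; simp; ring
        · have hw : wt lam (m + Pi.single l 1 + Pi.single k 1) k -
              wt lam (m + Pi.single l 1 + Pi.single k 1) l = wt lam m k - wt lam m l := by
            rw [wt_add_self, wt_add_ne _ _ _ _ _ (Ne.symm hkl), wt_add_self, wt_add_ne _ _ _ _ _ hkl]
            ring
          rw [hw]
          simp [hkl]
          ring
      · by_cases h2 : k = c ∧ l = x
        · obtain ⟨rfl, rfl⟩ := h2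
          have hkl : k ≠ l := fun h0 => h1 ⟨h0, h0.symm⟩
          have hw : wt lam (m + Pi.single k 1 + Pi.single l 1) l -
              wt lam (m + Pi.single k 1 + Pi.single l 1) k = wt lam m l - wt lam m k := by
            rw [wt_add_self, wt_add_ne _ _ _ _ _ hkl, wt_add_self, wt_add_ne _ _ _ _ _ hkl.symm]
            ring
          rw [hw, add_right_comm m (Pi.single k 1)]
          simp [hkl, hkl.symm]
          ring_nf
        · have h1' : ¬ (x ≠ c ∧ k = x ∧ l = c) := fun h0 => h1 h0.2
          rw [if_neg h1', if_neg h2]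
          have h3 : ¬ (x = k ∧ c = l) := fun h0 => h1 ⟨h0.1.symm, h0.2.symm⟩
          have h4 : ¬ (x = l ∧ c = k) := fun h0 => h2 ⟨h0.2.symm, h0.1.symm⟩
          simp only [← ite_and, if_neg h3, if_neg h4]
          simp
    simp only [e, Finset.sum_add_distrib, Finset.sum_ite_irrel, Finset.sum_const_zero,
      Finset.sum_ite_eq', Finset.mem_univ, if_true]
    rcases lt_trichotomy k l with hij | rfl | hij
    · have key := opFree_del_del_aux A lam hlam m hij
      have g0 := wt_ne hlam m k l hij.ne 0
      simp only [Int.cast_zero] at g0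
      rw [if_neg hij.ne, if_neg hij.le.not_gt, key]
      field_simp
      ring
    · simp; ring
    · have key := opFree_del_del_aux A lam hlam m hij
      have g0 := wt_ne hlam m l k hij.ne 0
      simp only [Int.cast_zero] at g0
      have h2 : wt lam m k - wt lam m l = -(wt lam m l - wt lam m k) := by ring
      rw [if_neg hij.ne', if_pos hij, h2, ← mul_assoc, key]
      field_simp
      ring
  | x_del i j =>
    ext f m
    simp only [map_mul, map_sum, map_sub, LinearMap.sum_apply,
      LinearMap.sub_apply, Pi.sub_apply, Module.End.mul_apply, Finset.sum_apply]
    by_cases hij : i = j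
    · subst hij
      simp only [if_true, opFree, FreeAlgebra.lift_ι_apply, opX, opDel, opCoef, LinearMap.coe_mk,
        AddHom.coe_mk]
      have key := opFree_x_del_self A lam hlam m i
      rw [sub_add_cancel, ← mul_assoc, key, sub_mul, Finset.sum_mul]
      congr 1
      refine Finset.sum_congr rfl fun k _ => ?_
      rw [Finset.sum_eq_single k]
      · rw [evalAt_RMat, add_sub_cancel_right]
        by_cases hk : k = i
        · subst hk; simp; ring
        · simp [hk, wt_add_self, wt_add_ne _ _ _ _ _ (Ne.symm hk)]
          ring
      · intro c _ hc
        rw [evalAt_RMat, if_neg (fun h0 => hc h0.2.1), if_neg]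
        · simp
        · rintro ⟨rfl, rfl⟩
          exact hc rfl
      · simp
    · simp only [if_neg (Ne.symm hij), map_zero, opFree, FreeAlgebra.lift_ι_apply, opX, opDel,
        opCoef, LinearMap.coe_mk, AddHom.coe_mk, LinearMap.zero_apply, Pi.zero_apply, sub_zero]
      rw [Finset.sum_eq_single j, Finset.sum_eq_single i]
      · rw [evalAt_RMat, if_neg (fun h0 => hij h0.2.2.symm), if_pos ⟨rfl, rfl⟩, wt_add_self,
          wt_add_ne _ _ _ _ _ hij, sub_add_eq_add_sub]
        rcases lt_or_gt_of_ne hij with h1 | h1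
        · rw [if_neg h1.le.not_gt, auxB_of_lt h1 (wt_sub_ne lam m i 1),
            auxA_of_le h1 (wt_add_ne lam m j 1)]
          ring
        · have g0 := wt_ne hlam m j i h1.ne 0
          have g1 := wt_ne hlam m j i h1.ne (-1)
          have g2 := wt_ne hlam m j i h1.ne (-2)
          have h3 : wt lam m j - wt lam m i + 1 ≠ 0 := fun h0 => g1 (by
            push_cast
            linear_combination h0)
          have h4 : wt lam m j - wt lam m i + 2 ≠ 0 := fun h0 => g2 (by
            push_cast
            linear_combination h0)
          simp only [Int.cast_zero] at g0
          have h5 : wt lam m i - wt lam m j - 1 = -(wt lam m j - wt lam m i + 1) := by ring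
          rw [if_pos h1, auxB_of_gt h1 (wt_sub_ne lam m i 1) g0, wt_sub_self,
            auxA_of_gt h1 (wt_add_ne lam m j 1) (by rw [h5]; exact neg_ne_zero.mpr h3),
            wt_add_self]
          have h6 : wt lam m i - (wt lam m j + 1) - 1 = -(wt lam m j - wt lam m i + 2) := by ring
          have h7 : wt lam m j - (wt lam m i - 1) = wt lam m j - wt lam m i + 1 := by ring
          have h8 : wt lam m j + 1 - wt lam m i = wt lam m j - wt lam m i + 1 := by ring
          rw [h5, h6, h7, h8]
          generalize wt lam m j - wt lam m i = y at *
          field_simp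
          ring
      · intro c _ hc
        rw [evalAt_RMat, if_neg (fun h0 => hij h0.2.2.symm), if_neg (fun h0 => hc h0.1)]
        simp
      · simp
      · intro k _ hk
        refine Finset.sum_eq_zero fun c _ => ?_
        rw [evalAt_RMat, if_neg (fun h0 => hij h0.2.2.symm), if_neg (fun h0 => hk h0.2.symm)]
        simp
      · simp

/-- The auxiliary action of the ring of h-deformed differential operators. -/
theorem exists_action {σ : UBar K n} (hσ : σ ∈ W K n) (lam : Fin n → K)
    (hlam : ∀ i j, i ≠ j → ∀ a : ℤ, lam i - lam j ≠ (a : K)) :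
    ∃ (A : Fin n → Polynomial K) (Φ : DiffPot σ →ₐ[K] Module.End K ((Fin n → ℤ) → K)),
      (∀ u, Φ (DiffRing.coef _ u) = opCoef lam hlam u) ∧
      (∀ i, Φ (DiffRing.del _ i) = opDel A lam i) := by
  obtain ⟨A, rfl⟩ := exists_of_mem_W hσ
  refine ⟨A, RingQuot.liftAlgHom K
    ⟨opFree A lam hlam, fun {_ _} hpq => opFree_rel A lam hlam hpq⟩, fun u => ?_, fun i => ?_⟩
  · refine (RingQuot.liftAlgHom_mkAlgHom_apply K _ _ _).trans ?_
    simp [opFree]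
  · refine (RingQuot.liftAlgHom_mkAlgHom_apply K _ _ _).trans ?_
    simp [opFree]

/-- The formulas `h i ↦ lam i`, `∂̄ᵢ ↦ 0` define a unique one-dimensional representation
(a character) of the ring `𝔇ₙ`. -/
theorem existsUnique_character {σ : UBar K n} (hσ : σ ∈ W K n) (lam : Fin n → K)
    (hlam : ∀ i j, i ≠ j → ∀ a : ℤ, lam i - lam j ≠ (a : K)) :
    ∃! χ : DSub σ →ₐ[K] K,
      (∀ i, χ (DSub.coef σ (h i)) = lam i) ∧ (∀ i, χ (DSub.del σ i) = 0) := by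
  obtain ⟨A, Φ, hΦ, hΦ'⟩ := exists_action hσ lam hlam
  let S : Set ((Fin n → ℤ) → K) := {f | ∀ m, m ≠ 0 → 0 ≤ ∑ i, m i → f m = 0}
  let δ : (Fin n → ℤ) → K := Pi.single 0 1
  have hδ : δ ∈ S := fun m hm _ => by simp [δ, hm]
  have hδ0 : δ 0 = 1 := by simp [δ]
  let P : DiffPot σ → K → Prop := fun d c => ∀ f ∈ S, Φ d f ∈ S ∧ Φ d f 0 = c * f 0
  have P_coef : ∀ u, P (DiffRing.coef _ u) (evalAt lam hlam u) := by
    intro u f hf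
    rw [hΦ]
    refine ⟨fun m hm hm' => ?_, ?_⟩
    · simp [opCoef, hf m hm hm']
    · have : wt lam 0 = lam := by ext i; simp [wt]
      simp [opCoef, this]
  have P_del : ∀ i, P (DiffRing.del _ i) 0 := by
    intro i f hf
    rw [hΦ']
    have key : ∀ m : Fin n → ℤ, 0 ≤ ∑ i, m i → f (m + Pi.single i 1) = 0 := by
      intro m hm
      have hs : ∑ j, (m + (Pi.single i 1 : Fin n → ℤ)) j = (∑ j, m j) + 1 := by
        simp [Finset.sum_add_distrib]
      refine hf _ (fun h0 => ?_) (by omega)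
      rw [h0] at hs
      simp at hs
      omega
    refine ⟨fun m _ hm' => ?_, ?_⟩
    · simp [opDel, key m hm']
    · have := key 0 (by simp)
      simp only [zero_add] at this
      simp [opDel, this]
  have P_add : ∀ a b c d, P a c → P b d → P (a + b) (c + d) := by
    intro a b c d ha hb f hf
    refine ⟨fun m hm hm' => ?_, ?_⟩
    · simp [(ha f hf).1 m hm hm', (hb f hf).1 m hm hm']
    · simp [(ha f hf).2, (hb f hf).2, add_mul]
  have P_mul : ∀ a b c d, P a c → P b d → P (a * b) (c * d) := by
    intro a b c d ha hb f hf
    rw [map_mul, Module.End.mul_apply]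
    exact ⟨(ha _ (hb f hf).1).1, by rw [(ha _ (hb f hf).1).2, (hb f hf).2, mul_assoc]⟩
  have P_scalar : ∀ r : K, P (algebraMap K _ r) r := by
    intro r f hf
    simp only [AlgHom.commutes, Module.algebraMap_end_apply]
    exact ⟨fun m hm hm' => by simp [hf m hm hm'], by simp⟩
  have P_ex : ∀ d ∈ DSub σ, ∃ c, P d c := by
    intro d hd
    induction hd using Algebra.adjoin_induction with
    | mem x hx =>
      rcases hx with ⟨u, rfl⟩ | ⟨i, rfl⟩
      · exact ⟨_, P_coef u⟩
      · exact ⟨_, P_del i⟩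
    | algebraMap r => exact ⟨r, P_scalar r⟩
    | add x y _ _ hx hy =>
      obtain ⟨c, hc⟩ := hx
      obtain ⟨d, hd⟩ := hy
      exact ⟨_, P_add _ _ _ _ hc hd⟩
    | mul x y _ _ hx hy =>
      obtain ⟨c, hc⟩ := hx
      obtain ⟨d, hd⟩ := hy
      exact ⟨_, P_mul _ _ _ _ hc hd⟩
  have P_val : ∀ d c, P d c → Φ d δ 0 = c := by
    intro d c hd
    rw [(hd δ hδ).2, hδ0, mul_one]
  refine ⟨{ toFun := fun d => Φ d δ 0
            map_one' := P_val _ _ (by simpa using P_scalar 1)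
            map_zero' := by simp
            map_add' := fun a b => by simp
            map_mul' := fun a b => ?_
            commutes' := fun r => P_val _ _ (P_scalar r) }, ⟨fun i => ?_, fun i => ?_⟩, ?_⟩
  · obtain ⟨c, hc⟩ := P_ex a a.2
    obtain ⟨d, hd⟩ := P_ex b b.2
    rw [P_val _ _ hc, P_val _ _ hd]
    exact P_val _ _ (P_mul _ _ _ _ hc hd)
  · exact (P_val _ _ (P_coef (h i))).trans (evalAt_h _ _ _)
  · exact P_val _ _ (P_del i)
  · rintro χ ⟨h1, h2⟩
    have hc : ∀ u, χ (DSub.coef σ u) = evalAt lam hlam u := by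
      intro u
      let g : UBar K n →ₐ[K] DSub σ :=
        (DiffRing.coef (fun i => Delta i σ)).codRestrict (DSub σ) (fun u => (DSub.coef σ u).2)
      have : χ.comp g = evalAt lam hlam :=
        uBar_hom_ext fun i => (h1 i).trans (evalAt_h _ _ _).symm
      exact DFunLike.congr_fun this u
    ext ⟨d, hd⟩
    refine Eq.trans (b := Φ d δ 0) ?_ rfl
    induction hd using Algebra.adjoin_induction with
    | mem x hx =>
      rcases hx with ⟨u, rfl⟩ | ⟨i, rfl⟩
      · exact (hc u).trans (P_val _ _ (P_coef u)).symm
      · exact (h2 i).trans (P_val _ _ (P_del i)).symm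
    | algebraMap r => exact (χ.commutes r).trans (P_val _ _ (P_scalar r)).symm
    | add x y hx' hy' hx hy =>
      have : χ (⟨x, hx'⟩ + ⟨y, hy'⟩) = Φ (x + y) δ 0 := by
        rw [map_add, hx, hy]; simp
      exact this
    | mul x y hx' hy' hx hy =>
      obtain ⟨c, hc⟩ := P_ex x hx'
      obtain ⟨d, hd⟩ := P_ex y hy'
      have : χ (⟨x, hx'⟩ * ⟨y, hy'⟩) = Φ (x * y) δ 0 := by
        rw [map_mul, hx, hy, P_val _ _ hc, P_val _ _ hd, P_val _ _ (P_mul _ _ _ _ hc hd)]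
      exact this

/-- The character of `𝔇ₙ` by which it acts on the basis vector of `M_lam`:
`h i ↦ lam i`, `∂̄ᵢ ↦ 0`. -/
def lowestCharacter {σ : UBar K n} (hσ : σ ∈ W K n) (lam : Fin n → K)
    (hlam : ∀ i j, i ≠ j → ∀ a : ℤ, lam i - lam j ≠ (a : K)) : DSub σ →ₐ[K] K :=
  (existsUnique_character hσ lam hlam).choose

/-- The one-dimensional `K`-vector space `M_lam`, with basis vector `1`. -/
def LowestLine {σ : UBar K n} (_hσ : σ ∈ W K n) (lam : Fin n → K)
    (_hlam : ∀ i j, i ≠ j → ∀ a : ℤ, lam i - lam j ≠ (a : K)) : Type _ := K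

end Character

section Induction

variable {K : Type*} [Field K] {n : ℕ} {σ : UBar K n} (hσ : σ ∈ W K n) (lam : Fin n → K)
  (hlam : ∀ i j, i ≠ j → ∀ a : ℤ, lam i - lam j ≠ (a : K))

instance : AddCommGroup (LowestLine hσ lam hlam) := inferInstanceAs (AddCommGroup K)
instance : Module K (LowestLine hσ lam hlam) := inferInstanceAs (Module K K)

/-- The `𝔇ₙ`-module structure on `M_lam`. -/
instance : Module (DSub σ) (LowestLine hσ lam hlam) :=
  Module.compHom K (lowestCharacter hσ lam hlam).toRingHom

/-- The basis vector `| ⟩` of `M_lam`. -/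
def vac : LowestLine hσ lam hlam := (1 : K)

theorem h_smul_vac (i : Fin n) :
    DSub.coef σ (h i) • vac hσ lam hlam = lam i • vac hσ lam hlam := by
  change lowestCharacter hσ lam hlam (DSub.coef σ (h i)) * (1 : K) = lam i * 1
  rw [lowestCharacter, ((existsUnique_character hσ lam hlam).choose_spec.1).1 i]

theorem del_smul_vac (i : Fin n) : DSub.del σ i • vac hσ lam hlam = 0 := by
  change lowestCharacter hσ lam hlam (DSub.del σ i) * (1 : K) = 0
  rw [lowestCharacter, ((existsUnique_character hσ lam hlam).choose_spec.1).2 i, zero_mul]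

/-- The submodule of `A ⊗_K M` by which one divides to get `A ⊗_B M`, for a subalgebra `B` of a
(noncommutative) algebra `A` and a left `B`-module `M`. -/
def balancedSubmodule {A : Type*} [Ring A] [Algebra K A] (B : Subalgebra K A)
    (M : Type*) [AddCommGroup M] [Module K M] [Module B M] : Submodule A (A ⊗[K] M) :=
  Submodule.span A {w | ∃ (a : A) (b : B) (m : M), w = (a * (b : A)) ⊗ₜ[K] m - a ⊗ₜ[K] (b • m)}

/-- The induced module `Ind_B^A M = A ⊗_B M`. -/
abbrev Ind {A : Type*} [Ring A] [Algebra K A] (B : Subalgebra K A)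
    (M : Type*) [AddCommGroup M] [Module K M] [Module B M] : Type _ :=
  (A ⊗[K] M) ⧸ balancedSubmodule B M

/-- The lowest weight representation of `Diff_{h,σ}(n)` of lowest weight `lam`. -/
abbrev LowestWeightRep : Type _ := Ind (DSub σ) (LowestLine hσ lam hlam)

end Induction

end HDeformed

end

noncomputable section

namespace HDeformed

open scoped TensorProduct

/-! ### Exchange relations between `Ū(n)`, the `xⁱ`, the `∂̄ⱼ` and the products `∂̄ⱼ xʲ`. -/

section Relations

variable {K : Type*} [Field K] {n : ℕ}

/-! Write Γⱼ = ∂̄ⱼ xʲ and eⱼ(t) = e(t)/(1 + hⱼ t). The coefficients of c(t) are central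
(`DiffRing.mul_cCoeff`), and the induced module is generated by the vectors v = 1 ⊗ m, so it is
enough to find the action on v (`cCoeff_smul_of`).

Centrality: the quadratic relations give xⁱ Γⱼ = Tᵢⱼ xⁱ and Γⱼ ∂̄ᵢ = ∂̄ᵢ Tᵢⱼ with the same Tᵢⱼ, an
affine expression in the Γ's over `Ū(n)`. Carrying xⁱ or ∂̄ᵢ across c(t) also shifts the
coefficients by -εᵢ. The coefficient of each Γⱼ is restored by a partial fraction identity
(`eDiv_transport`), and the free term by the equation Δᵢρ = eᵢ σᵢ
(`DiffRing.sum_coef_mul_transported`).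

Action on v: since ∂̄ᵢ v = 0, the relation for xⁱ ∂̄ᵢ gives the Cauchy system ∑ₖ Γₖ v / (λₖ - λᵢ +
1) = σᵢ(λ) v. The system is not inverted. Instead, ∑ⱼ eⱼ(t) Γⱼ v and (ρ - ρ[-ε])(t) v, both of
degree less than n in t and taken at h = λ, are compared at the n points t = 1/(1 - λᵢ), in
homogeneous form because a point may be infinite. There the Cauchy system computes the first. For
the second, the shift by -ε is made one coordinate at a time, starting with -εᵢ; after that, every
other step contributes a multiple of 1 + (λᵢ - 1)t, which vanishes (`eval_reflect_specialize_sub`).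
The values agree, so c(t) v = (ρ - ρ[-ε] - ρ) v = -ρ[-ε] v. -/

theorem shift_shift (v w : Fin n → ℤ) (u : UBar K n) :
    shift v (shift w u) = shift (v + w) u := by
  have : (shift v).comp (shift w) = (shift (v + w) : UBar K n →ₐ[K] UBar K n) :=
    uBar_hom_ext fun i => by simp; ring
  exact DFunLike.congr_fun this u

theorem shift_zero (u : UBar K n) : shift 0 u = u := by
  have : shift 0 = AlgHom.id K (UBar K n) := uBar_hom_ext fun i => by simp
  exact DFunLike.congr_fun this u

theorem shift_inverse (v : Fin n → ℤ) {u : UBar K n} (hu : IsUnit u) :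
    shift v (Ring.inverse u) = Ring.inverse (shift v u) := by
  have hu' := hu.map (shift v)
  apply hu'.mul_left_cancel
  rw [Ring.mul_inverse_cancel _ hu', ← map_mul, Ring.mul_inverse_cancel _ hu, map_one]

/-- An element that intertwines the generators `h i` with their translates intertwines every
element of `Ū(n)` with its translate. -/
theorem mul_eq_mul_shift {A : Type*} [Ring A] [Algebra K A] (κ : UBar K n →ₐ[K] A) (y : A)
    (v : Fin n → ℤ) (hy : ∀ i, κ (h i) * y = y * κ (shift v (h i))) (f : UBar K n) :
    κ f * y = y * κ (shift v f) := by
  have poly : ∀ p : MvPolynomial (Fin n) K,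
      κ (algebraMap _ _ p) * y = y * κ (shift v (algebraMap _ _ p)) := by
    intro p
    induction p using MvPolynomial.induction_on with
    | C r =>
      have : algebraMap (MvPolynomial (Fin n) K) (UBar K n) (MvPolynomial.C r)
          = algebraMap K _ r := (IsScalarTower.algebraMap_apply K _ _ r).symm
      rw [this, AlgHom.commutes, AlgHom.commutes, AlgHom.commutes, Algebra.commutes]
    | add p q hp hq => simp only [map_add, add_mul, mul_add, hp, hq]
    | mul_X p i hp =>
      have := hy i
      rw [h] at this
      rw [map_mul, map_mul, mul_assoc, this, ← mul_assoc, hp, mul_assoc, ← map_mul, ← map_mul]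
  -- With `f` = p/s, the claim for `f` follows from those for `p` and `s` once the unit `κ s` is
  -- cancelled on the left.
  obtain ⟨⟨p, s⟩, hps⟩ := IsLocalization.surj (denominators K n) f
  have hs : IsUnit (κ (algebraMap _ (UBar K n) (s : MvPolynomial (Fin n) K))) :=
    (IsLocalization.map_units (UBar K n) s).map κ
  apply hs.mul_left_cancel
  rw [← mul_assoc, ← map_mul, mul_comm, hps, poly, ← mul_assoc, poly, ← hps, map_mul, map_mul,
    mul_assoc, ← map_mul, mul_comm (shift v f), map_mul]

variable (s : Fin n → UBar K n)

namespace DiffRing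

theorem coef_mul_x (j : Fin n) (f : UBar K n) :
    coef s f * x s j = x s j * coef s (shift (Pi.single j 1) f) := by
  refine mul_eq_mul_shift (coef s) _ _ (fun i => ?_) f
  have := mk_rel (Rel.weight_x (s := s) i j)
  rw [map_mul, map_mul, map_add] at this
  refine Eq.trans this ?_
  rw [shift_h, map_add]
  congr 2
  by_cases hij : i = j
  · subst hij; simp
  · simp [hij]

theorem coef_mul_del (j : Fin n) (f : UBar K n) :
    coef s f * del s j = del s j * coef s (shift (-Pi.single j 1) f) := by
  refine mul_eq_mul_shift (coef s) _ _ (fun i => ?_) f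
  have := mk_rel (Rel.weight_del (s := s) i j)
  rw [map_mul, map_mul, map_sub, sub_eq_add_neg] at this
  refine Eq.trans this ?_
  rw [shift_h, map_add]
  congr 2
  by_cases hij : i = j
  · subst hij; simp
  · simp [hij]

theorem x_mul_coef (j : Fin n) (f : UBar K n) :
    x s j * coef s f = coef s (shift (-Pi.single j 1) f) * x s j := by
  rw [coef_mul_x, shift_shift, add_neg_cancel, shift_zero]

theorem del_mul_coef (j : Fin n) (f : UBar K n) :
    del s j * coef s f = coef s (shift (Pi.single j 1) f) * del s j := by
  rw [coef_mul_del, shift_shift, neg_add_cancel, shift_zero]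

/-- The shifts caused by `∂̄ⱼ` and `xʲ` cancel: their product has weight zero. -/
theorem coef_mul_del_mul_x (j : Fin n) (f : UBar K n) :
    coef s f * (del s j * x s j) = del s j * x s j * coef s f := by
  rw [← mul_assoc, coef_mul_del, mul_assoc, coef_mul_x, shift_shift, add_neg_cancel, shift_zero,
    mul_assoc]

end DiffRing

/-- Used to collapse the sums over R-matrix entries: `R^{ij}_{kl}` vanishes unless (k, l) is (i, j)
or (j, i). -/
theorem sum_sum_eq_add {ι M : Type*} [Fintype ι] [DecidableEq ι] [AddCommMonoid M] {i j : ι}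
    (hij : i ≠ j) (F : ι → ι → M)
    (hF : ∀ k l, ¬(k = i ∧ l = j) → ¬(k = j ∧ l = i) → F k l = 0) :
    ∑ k, ∑ l, F k l = F i j + F j i := by
  rw [← Fintype.sum_prod_type']
  refine Fintype.sum_eq_add (i, j) (j, i) (by simp [hij]) ?_
  rintro ⟨k, l⟩ ⟨h1, h2⟩
  exact hF k l (by simpa using h1) (by simpa using h2)

theorem RMat_same (i j : Fin n) (hij : i ≠ j) :
    (RMat i j i j : UBar K n) = Ring.inverse (h i - h j) := by
  simp [RMat, hij]

theorem RMat_swap (i j : Fin n) (hij : i ≠ j) :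
    (RMat i j j i : UBar K n) =
      if i < j then ((h i - h j) ^ 2 - 1) * Ring.inverse ((h i - h j) ^ 2) else 1 := by
  rw [RMat, if_neg (fun h0 => hij h0.2.1.symm), if_pos ⟨rfl, rfl⟩]

theorem RMat_eq_zero {i j k l : Fin n} (h1 : ¬(k = i ∧ l = j)) (h2 : ¬(k = j ∧ l = i)) :
    (RMat i j k l : UBar K n) = 0 := by
  rw [RMat, if_neg (fun h0 => h1 h0.2), if_neg h2]

/-- Put d = hᵢ - hⱼ. The factor d/(d - 1) inverts 1 - 1/d, which is what solves the exchange
relations for one ordering of the generators. Of the two swap entries one is 1 and the other is (d²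
- 1)/d², even in d, so their product does not depend on which of i, j is smaller. -/
theorem RMat_mul_RMat_mul (i j : Fin n) (hij : i ≠ j) :
    (h i - h j) * Ring.inverse (h i - h j - 1) * (1 - RMat i j i j) = (1 : UBar K n) ∧
    RMat j i i j * ((h i - h j) * Ring.inverse (h i - h j - 1) * RMat i j j i) =
      ((h i - h j + 1) * Ring.inverse (h i - h j) : UBar K n) := by
  have D := Ring.mul_inverse_cancel _ (isUnit_h_sub' (K := K) i j hij)
  have U := Ring.mul_inverse_cancel _ (isUnit_h_sub (K := K) i j hij (-1))
  have hji : ((h j : UBar K n) - h i) ^ 2 = (h i - h j) ^ 2 := by ring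
  rw [RMat_same i j hij, RMat_swap i j hij, RMat_swap j i hij.symm, hji, ← Ring.inverse_pow]
  push_cast [← sub_eq_add_neg] at U
  generalize Ring.inverse ((h i : UBar K n) - h j) = d at *
  generalize Ring.inverse ((h i : UBar K n) - h j - 1) = u at *
  refine ⟨by linear_combination U - u * D, ?_⟩
  rcases lt_or_gt_of_ne hij with hlt | hlt
  · rw [if_pos hlt, if_neg hlt.not_gt]
    linear_combination u * ((h i - h j) ^ 2 - 1) * d * D + (h i - h j + 1) * d * U
  · rw [if_pos hlt, if_neg hlt.not_gt]
    linear_combination u * ((h i - h j) ^ 2 - 1) * d * D + (h i - h j + 1) * d * U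

namespace DiffRing

theorem x_mul_x (i j : Fin n) (hij : i ≠ j) :
    x s i * x s j = coef s (RMat i j i j) * x s i * x s j
      + coef s (RMat i j j i) * x s j * x s i := by
  have := mk_rel (Rel.x_x (s := s) i j)
  simp only [map_mul, map_sum] at this
  rw [sum_sum_eq_add hij] at this
  · exact this
  · intro k l h1 h2
    change coef s (RMat i j k l) * _ * _ = 0
    simp [RMat_eq_zero h1 h2]

theorem del_mul_del (k l : Fin n) (hkl : k ≠ l) :
    del s l * del s k = del s l * del s k * coef s (RMat k l k l)
      + del s k * del s l * coef s (RMat l k k l) := by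
  have := mk_rel (Rel.del_del (s := s) k l)
  simp only [map_mul, map_sum] at this
  rw [sum_sum_eq_add hkl] at this
  · exact this
  · intro i j h1 h2
    change _ * _ * coef s (RMat i j k l) = 0
    rw [RMat_eq_zero (by tauto) (by tauto)]
    simp

/-- For j ≠ i the entry `R^{ki}_{lj}` survives only at k = j, l = i. -/
theorem x_mul_del_of_ne (i j : Fin n) (hij : i ≠ j) :
    x s i * del s j = del s j * coef s (RMat j i i j) * x s i := by
  have := mk_rel (Rel.x_del (s := s) i j)
  simp only [map_mul, map_sum, if_neg hij.symm, sub_zero] at this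
  rw [Finset.sum_eq_single j, Finset.sum_eq_single i] at this
  · exact this
  · intro l _ hl
    change _ * coef s (RMat j i l j) * _ = 0
    rw [RMat_eq_zero (fun h0 => hij h0.2.symm) (by tauto)]
    simp
  · simp
  · intro k _ hk
    refine Finset.sum_eq_zero fun l _ => ?_
    change _ * coef s (RMat k i l j) * _ = 0
    rw [RMat_eq_zero (fun h0 => hij h0.2.symm) (by tauto)]
    simp
  · simp

/-- Only the entries `R^{ki}_{ki}` survive. Moving 1/(hₖ - hᵢ) to the left of `∂̄ₖ` turns it into
1/(hₖ - hᵢ + 1); at k = i this expression is 1, which is the diagonal entry, so one formula covers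
all k. -/
theorem x_mul_del_self (i : Fin n) :
    x s i * del s i =
      ∑ k, coef s (Ring.inverse (h k - h i + 1)) * (del s k * x s k) - coef s (s i) := by
  have := mk_rel (Rel.x_del (s := s) i i)
  simp only [map_mul, map_sum, map_sub, if_pos] at this
  refine Eq.trans this (congrArg (· - coef s (s i)) (Finset.sum_congr rfl fun k _ => ?_))
  change ∑ l, del s k * coef s (RMat k i l i) * x s l = _
  rw [Finset.sum_eq_single k]
  · by_cases hk : k = i
    · subst hk; simp [RMat]
    · rw [RMat_same k i hk, del_mul_coef, shift_inverse _ (isUnit_h_sub' k i hk), map_sub,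
        shift_h, shift_h, mul_assoc]
      simp only [Pi.single_eq_same, Pi.single_eq_of_ne (Ne.symm hk)]
      congr 4
      push_cast
      ring
  · intro l _ hl
    rw [RMat_eq_zero (fun h0 => hl h0.1) (fun h0 => hl (h0.1.trans h0.2))]
    simp
  · simp

/-- The exchange relation reads (1 - `R^{ij}_{ij}`) xⁱxʲ = `R^{ij}_{ji}` xʲxⁱ. The factor
`R^{ji}_{ij}` is the one that `x_mul_del_of_ne` produces; with it the resulting coefficient takes
the same form for i < j and i > j. -/
theorem RMat_mul_x_mul_x (i j : Fin n) (hij : i ≠ j) :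
    coef s (RMat j i i j) * (x s i * x s j) =
      coef s ((h i - h j + 1) * Ring.inverse (h i - h j)) * (x s j * x s i) := by
  obtain ⟨h1, h2⟩ := RMat_mul_RMat_mul (K := K) i j hij
  have key := x_mul_x s i j hij
  rw [mul_assoc, mul_assoc, ← sub_eq_iff_eq_add', ← one_sub_mul, ← map_one (coef s),
    ← map_sub] at key
  rw [← h2, map_mul, map_mul _ (_ * _) (RMat i j j i), mul_assoc, mul_assoc, ← key,
    ← mul_assoc (coef s (_ * _)), ← map_mul, h1, map_one, one_mul]

theorem del_mul_del_mul_RMat (i j : Fin n) (hij : i ≠ j) :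
    del s j * del s i * coef s (RMat i j j i) =
      del s i * del s j * coef s ((h i - h j + 1) * Ring.inverse (h i - h j)) := by
  obtain ⟨h1, h2⟩ := RMat_mul_RMat_mul (K := K) i j hij
  have key := del_mul_del s i j hij
  rw [← sub_eq_iff_eq_add', ← mul_one_sub, ← map_one (coef s), ← map_sub] at key
  rw [← h2, map_mul, ← mul_assoc, ← key, mul_assoc (del s j * del s i), ← map_mul, ← mul_assoc,
    mul_comm (1 - _), h1, one_mul]

/-- The exchange relation of `xⁱ` and `Γⱼ = ∂̄ⱼ xʲ` for `i ≠ j`. -/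
theorem x_mul_del_mul_x_of_ne (i j : Fin n) (hij : i ≠ j) :
    x s i * (del s j * x s j) =
      coef s ((h i - h j) * Ring.inverse (h i - h j - 1)) * (del s j * x s j) * x s i := by
  rw [← mul_assoc, x_mul_del_of_ne s i j hij, mul_assoc, mul_assoc, RMat_mul_x_mul_x s i j hij,
    ← mul_assoc, del_mul_coef, map_mul, shift_inverse _ (isUnit_h_sub' i j hij)]
  simp only [map_add, map_sub, shift_h, map_one, Pi.single_eq_same, Pi.single_eq_of_ne hij]
  have : (h i : UBar K n) + ((0 : ℤ) : UBar K n) - (h j + ((1 : ℤ) : UBar K n))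
      = h i - h j - 1 := by push_cast; ring
  rw [this, sub_add_cancel]
  simp only [mul_assoc]

/-- Mirror image of `x_mul_del_mul_x_of_ne`. That the same factor appears lets a single computation
prove commutation with both `xⁱ` and `∂̄ᵢ`. -/
theorem del_mul_x_mul_del_of_ne (i j : Fin n) (hij : i ≠ j) :
    del s j * x s j * del s i =
      del s i * (coef s ((h i - h j) * Ring.inverse (h i - h j - 1)) * (del s j * x s j)) := by
  rw [mul_assoc, x_mul_del_of_ne s j i hij.symm, ← mul_assoc, ← mul_assoc,
    del_mul_del_mul_RMat s i j hij, mul_assoc (del s i), del_mul_coef, map_mul,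
    shift_inverse _ (isUnit_h_sub' i j hij)]
  simp only [map_add, map_sub, shift_h, map_one, Pi.single_eq_same, Pi.single_eq_of_ne hij]
  have : (h i : UBar K n) + ((0 : ℤ) : UBar K n) - (h j + ((1 : ℤ) : UBar K n))
      = h i - h j - 1 := by push_cast; ring
  rw [this, sub_add_cancel]
  simp only [mul_assoc]

/-- The factor `αᵢⱼ` in `xⁱ Γⱼ = αᵢⱼ Γⱼ xⁱ`, `i ≠ j`, where `Γⱼ = ∂̄ⱼ xʲ`. -/
def crossFactor (i j : Fin n) : UBar K n :=
  if j = i then 0 else (h i - h j) * Ring.inverse (h i - h j - 1)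

/-- The element `Tᵢⱼ` with `xⁱ Γⱼ = Tᵢⱼ xⁱ` and `Γⱼ ∂̄ᵢ = ∂̄ᵢ Tᵢⱼ`, where `Γⱼ = ∂̄ⱼ xʲ`. -/
def transported (i j : Fin n) : DiffRing s :=
  coef s (crossFactor i j) * (del s j * x s j) +
    if j = i then
      ∑ k, coef s (Ring.inverse (h k - h i + 1)) * (del s k * x s k) - coef s (s i)
    else 0

theorem x_mul_del_mul_x (i j : Fin n) :
    x s i * (del s j * x s j) = transported s i j * x s i := by
  by_cases hij : j = i
  · subst hij
    rw [← mul_assoc, x_mul_del_self]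
    simp [transported, crossFactor]
  · rw [x_mul_del_mul_x_of_ne s i j (Ne.symm hij)]
    simp [transported, crossFactor, hij]

theorem del_mul_x_mul_del (i j : Fin n) :
    del s j * x s j * del s i = del s i * transported s i j := by
  by_cases hij : j = i
  · subst hij
    rw [mul_assoc, x_mul_del_self]
    simp [transported, crossFactor]
  · rw [del_mul_x_mul_del_of_ne s i j (Ne.symm hij)]
    simp [transported, crossFactor, hij]

/-- The coefficient of `tᵏ` in `∑ᵢ e(t)/(1 + h i t) Γᵢ - ρ(t)`. -/
def cCoeff (ρ : Polynomial (UBar K n)) (k : ℕ) : DiffRing s :=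
  ∑ j, coef s ((eDiv j).coeff k) * (del s j * x s j) - coef s (ρ.coeff k)

end DiffRing

/-! ### Transport of c(t) through the generators, and its centrality. -/

theorem eDiv_eq_mul (i j : Fin n) (hij : i ≠ j) :
    (eDiv i : Polynomial (UBar K n)) = (1 + Polynomial.C (h j) * Polynomial.X) *
      ∏ k ∈ (Finset.univ.erase i).erase j, (1 + Polynomial.C (h k) * Polynomial.X) :=
  (Finset.mul_prod_erase _ (fun k => 1 + Polynomial.C (h k : UBar K n) * Polynomial.X)
    (Finset.mem_erase.mpr ⟨hij.symm, Finset.mem_univ j⟩)).symm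

theorem map_shift_eDiv (v : Fin n → ℤ) (j : Fin n) :
    (eDiv j : Polynomial (UBar K n)).map (shift v).toRingHom =
      ∏ k ∈ Finset.univ.erase j, (1 + Polynomial.C (h k + (v k : UBar K n)) * Polynomial.X) := by
  simp [eDiv, Polynomial.map_prod]

theorem map_shift_eDiv_self (i : Fin n) :
    (eDiv i : Polynomial (UBar K n)).map (shift (-Pi.single i 1)).toRingHom = eDiv i := by
  rw [map_shift_eDiv, eDiv]
  refine Finset.prod_congr rfl fun k hk => ?_
  simp [Pi.single_eq_of_ne (Finset.ne_of_mem_erase hk)]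

/-- This is (1 + (a - 1)t)(a - b) - (1 + bt) = (a - b - 1)(1 + at), divided by a - b - 1 and
multiplied by `P`. -/
theorem linear_factor_transport {R : Type*} [CommRing R] (P : Polynomial R) {a b u : R}
    (hu : (a - b - 1) * u = 1) :
    (1 + Polynomial.C (a - 1) * Polynomial.X) * P * Polynomial.C ((a - b) * u) +
      (1 + Polynomial.C b * Polynomial.X) * P * Polynomial.C (-u) =
      (1 + Polynomial.C a * Polynomial.X) * P := by
  have hu' := congrArg Polynomial.C hu
  simp only [map_mul, map_sub, map_one, map_neg] at hu' ⊢
  linear_combination P * (1 + Polynomial.C a * Polynomial.X) * hu'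

/-- The left side is the coefficient of Γⱼ after `xⁱ` has crossed c(t): the first term comes from
the shifted eⱼΓⱼ, the second from the sum that Γᵢ turns into. For j ≠ i both products share the
factors with index outside {i, j}, and what remains is `linear_factor_transport` with a = hᵢ, b =
hⱼ. -/
theorem eDiv_transport (i j : Fin n) :
    (eDiv j : Polynomial (UBar K n)).map (shift (-Pi.single i 1)).toRingHom
        * Polynomial.C (DiffRing.crossFactor i j) +
      eDiv i * Polynomial.C (Ring.inverse (h j - h i + 1)) = eDiv j := by
  by_cases hij : j = i
  · subst hij
    simp [DiffRing.crossFactor]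
  · have U := Ring.mul_inverse_cancel _ (isUnit_h_sub (K := K) i j (Ne.symm hij) (-1))
    have V := Ring.mul_inverse_cancel _ (isUnit_h_sub (K := K) j i hij 1)
    push_cast [← sub_eq_add_neg] at U V
    have huv : Ring.inverse ((h j : UBar K n) - h i + 1)
        = -Ring.inverse ((h i : UBar K n) - h j - 1) := by
      linear_combination (-Ring.inverse ((h i : UBar K n) - h j - 1)) * V
        - Ring.inverse ((h j : UBar K n) - h i + 1) * U
    rw [map_shift_eDiv, ← Finset.mul_prod_erase _ _
      (Finset.mem_erase.mpr ⟨Ne.symm hij, Finset.mem_univ i⟩),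
      Finset.prod_congr rfl (g := fun k => 1 + Polynomial.C (h k : UBar K n) * Polynomial.X)
        (fun k hk => by simp [Pi.single_eq_of_ne (Finset.ne_of_mem_erase hk)]),
      eDiv_eq_mul i j (Ne.symm hij), eDiv_eq_mul j i hij, Finset.erase_right_comm,
      huv, DiffRing.crossFactor, if_neg hij]
    generalize Ring.inverse ((h i : UBar K n) - h j - 1) = u at *
    simp only [Pi.neg_apply, Pi.single_eq_same, Int.cast_neg, Int.cast_one, ← sub_eq_add_neg]
    exact linear_factor_transport _ U

namespace DiffRing

variable {s} {ρ : Polynomial (UBar K n)}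

/-- The coefficient of each Γⱼ is restored by `eDiv_transport`. The free term is -eᵢσᵢ - ρ[-εᵢ],
which is -ρ by the difference equation; here eᵢ is unshifted because it does not involve hᵢ. -/
theorem sum_coef_mul_transported
    (hρ : ∀ j : Fin n, ρ - ρ.map (shift (-Pi.single j 1)).toRingHom =
      eDiv j * Polynomial.C (s j)) (k : ℕ) (i : Fin n) :
    ∑ j, coef s (shift (-Pi.single i 1) ((eDiv j).coeff k)) * transported s i j
      - coef s (shift (-Pi.single i 1) (ρ.coeff k)) = cCoeff s ρ k := by
  have e1 : shift (-Pi.single i 1) ((eDiv i : Polynomial (UBar K n)).coeff k)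
      = (eDiv i).coeff k := by
    simpa using congrArg (Polynomial.coeff · k) (map_shift_eDiv_self (K := K) i)
  have e2 : ∀ j, shift (-Pi.single i 1) ((eDiv j : Polynomial (UBar K n)).coeff k)
      * crossFactor i j + (eDiv i).coeff k * Ring.inverse (h j - h i + 1) = (eDiv j).coeff k :=
    fun j => by simpa using congrArg (Polynomial.coeff · k) (eDiv_transport (K := K) i j)
  have e3 : ρ.coeff k - shift (-Pi.single i 1) (ρ.coeff k) = (eDiv i).coeff k * s i := by
    simpa using congrArg (Polynomial.coeff · k) (hρ i)
  simp only [transported, mul_add, Finset.sum_add_distrib, mul_ite, mul_zero,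
    Finset.sum_ite_eq', Finset.mem_univ, if_true, e1, mul_sub, Finset.mul_sum]
  rw [cCoeff, ← add_sub_assoc, ← Finset.sum_add_distrib, sub_sub, ← map_mul, ← map_add, ← e3,
    sub_add_cancel]
  congr 1
  refine Finset.sum_congr rfl fun j _ => ?_
  rw [← mul_assoc (coef s _), ← mul_assoc (coef s _), ← map_mul, ← map_mul, ← add_mul, ← map_add,
    e2]

theorem x_mul_cCoeff
    (hρ : ∀ j : Fin n, ρ - ρ.map (shift (-Pi.single j 1)).toRingHom =
      eDiv j * Polynomial.C (s j)) (k : ℕ) (i : Fin n) :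
    x s i * cCoeff s ρ k = cCoeff s ρ k * x s i := by
  conv_rhs => rw [← sum_coef_mul_transported hρ k i]
  rw [cCoeff, mul_sub, sub_mul, x_mul_coef, Finset.mul_sum, Finset.sum_mul]
  congr 1
  refine Finset.sum_congr rfl fun j _ => ?_
  rw [← mul_assoc, x_mul_coef, mul_assoc, x_mul_del_mul_x, mul_assoc]

theorem cCoeff_mul_del
    (hρ : ∀ j : Fin n, ρ - ρ.map (shift (-Pi.single j 1)).toRingHom =
      eDiv j * Polynomial.C (s j)) (k : ℕ) (i : Fin n) :
    cCoeff s ρ k * del s i = del s i * cCoeff s ρ k := by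
  conv_rhs => rw [← sum_coef_mul_transported hρ k i]
  rw [cCoeff, mul_sub, sub_mul, coef_mul_del, Finset.mul_sum, Finset.sum_mul]
  congr 1
  refine Finset.sum_congr rfl fun j _ => ?_
  rw [mul_assoc, del_mul_x_mul_del, ← mul_assoc, coef_mul_del, mul_assoc]

theorem coef_mul_cCoeff (k : ℕ) (f : UBar K n) :
    coef s f * cCoeff s ρ k = cCoeff s ρ k * coef s f := by
  rw [cCoeff, mul_sub, sub_mul, ← map_mul, ← map_mul, mul_comm f, Finset.mul_sum, Finset.sum_mul]
  congr 1
  refine Finset.sum_congr rfl fun j _ => ?_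
  rw [mul_assoc, ← coef_mul_del_mul_x, ← mul_assoc (coef s _), ← mul_assoc (coef s _), ← map_mul,
    ← map_mul, mul_comm f]

/-- The coefficients of `c(t)` are central. -/
theorem mul_cCoeff
    (hρ : ∀ j : Fin n, ρ - ρ.map (shift (-Pi.single j 1)).toRingHom =
      eDiv j * Polynomial.C (s j)) (k : ℕ) (a : DiffRing s) :
    a * cCoeff s ρ k = cCoeff s ρ k * a := by
  obtain ⟨a, rfl⟩ : ∃ b, mk s b = a := RingQuot.mkAlgHom_surjective K (Rel s) a
  induction a using FreeAlgebra.induction with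
  | grade0 r => rw [AlgHom.commutes, Algebra.commutes]
  | grade1 g =>
    cases g with
    | coef u => exact coef_mul_cCoeff k u
    | x i => exact x_mul_cCoeff hρ k i
    | del i => exact (cCoeff_mul_del hρ k i).symm
  | mul a b ha hb => rw [map_mul, mul_assoc, hb, ← mul_assoc, ha, mul_assoc]
  | add a b ha hb => rw [map_add, add_mul, mul_add, ha, hb]

end DiffRing

end Relations

/-! ### Interpolation of polynomials in homogeneous form. -/

section Interpolation

theorem reflect_sum {R ι : Type*} [Semiring R] (S : Finset ι) (f : ι → Polynomial R) (N : ℕ) :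
    Polynomial.reflect N (∑ k ∈ S, f k) = ∑ k ∈ S, Polynomial.reflect N (f k) := by
  ext m
  simp [Polynomial.coeff_reflect, Polynomial.finsetSum_coeff]

/-- Each factor 1 + at becomes t + a. The reflection is taken at the number of factors, not at the
actual degree, which drops when some `a k` is zero. -/
theorem reflect_prod_one_add {R ι : Type*} [CommRing R] (S : Finset ι) (a : ι → R) :
    Polynomial.reflect S.card (∏ k ∈ S, (1 + Polynomial.C (a k) * Polynomial.X)) =
      ∏ k ∈ S, (Polynomial.X + Polynomial.C (a k)) := by
  classical
  have deg : ∀ r : R, (1 + Polynomial.C r * Polynomial.X).natDegree ≤ 1 := fun r => by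
    compute_degree
  induction S using Finset.induction_on with
  | empty => simp
  | insert i S hi ih =>
    rw [Finset.prod_insert hi, Finset.prod_insert hi, Finset.card_insert_of_notMem hi, add_comm,
      Polynomial.reflect_mul _ _ (deg _), ih, Polynomial.reflect_add, Polynomial.reflect_C_mul,
      Polynomial.reflect_one_X, Polynomial.reflect_one, pow_one, mul_one]
    refine (Polynomial.natDegree_prod_le _ _).trans ((Finset.sum_le_card_nsmul _ _ 1
      (fun k _ => deg _)).trans (by simp))

/-- A polynomial of degree less than `n` is determined by the values of its homogenization of
degree `n - 1` at `n` distinct points `(1 : z i)` of the projective line. -/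
theorem eq_of_eval_reflect_eq {F : Type*} [Field F] {n : ℕ} {f g : Polynomial F} (hf : f.degree < n)
    (hg : g.degree < n) {z : Fin n → F} (hz : Function.Injective z)
    (hfg : ∀ i, (f.reflect (n - 1)).eval (z i) = (g.reflect (n - 1)).eval (z i)) : f = g := by
  -- For n = 0 the subtraction n - 1 is truncated and reflecting at 0 need not respect the degree
  -- bound; but then both polynomials are zero.
  rcases Nat.eq_zero_or_pos n with rfl | hn
  · have key : ∀ {q : Polynomial F}, q.degree < ((0 : ℕ) : WithBot ℕ) → q = 0 := fun hq =>
      Polynomial.degree_eq_bot.mp (by simpa using hq)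
    rw [key hf, key hg]
  · have key : ∀ {q : Polynomial F}, q.degree < (n : WithBot ℕ) →
        (q.reflect (n - 1)).degree < (Finset.univ : Finset (Fin n)).card := by
      intro q hq
      rw [Finset.card_fin, Polynomial.degree_lt_iff_coeff_zero]
      intro m hm
      rw [Polynomial.coeff_reflect, Polynomial.revAt_eq_self_of_lt (by omega)]
      exact (Polynomial.degree_lt_iff_coeff_zero _ _).mp hq m hm
    have := Polynomial.eq_of_degrees_lt_of_eval_index_eq Finset.univ hz.injOn (key hf) (key hg)
      (fun i _ => hfg i)
    simpa using congrArg (Polynomial.reflect (n - 1)) this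

end Interpolation

/-! ### The difference equation for ρ at a numerical weight. -/

section Specialization

variable {K : Type*} [Field K] {n : ℕ} (lam : Fin n → K)
  (hlam : ∀ i j, i ≠ j → ∀ a : ℤ, lam i - lam j ≠ (a : K))

/-- The specialization of `e(t) / (1 + h i t)` at `h = z`. -/
def eDivAt (z : Fin n → K) (i : Fin n) : Polynomial K :=
  ∏ k ∈ Finset.univ.erase i, (1 + Polynomial.C (z k) * Polynomial.X)

theorem eval_reflect_eDivAt (z : Fin n → K) (i : Fin n) (t : K) :
    ((eDivAt z i).reflect (n - 1)).eval t = ∏ k ∈ Finset.univ.erase i, (t + z k) := by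
  have : n - 1 = (Finset.univ.erase i).card := by simp
  rw [eDivAt, this, reflect_prod_one_add, Polynomial.eval_prod]
  simp

theorem degree_eDivAt_lt (z : Fin n → K) (i : Fin n) : (eDivAt z i).degree < n := by
  have hn : 0 < n := i.pos
  refine lt_of_le_of_lt (Polynomial.degree_le_of_natDegree_le (n := n - 1) ?_)
    (by exact_mod_cast Nat.sub_lt hn one_pos)
  refine (Polynomial.natDegree_prod_le _ _).trans ((Finset.sum_le_card_nsmul _ _ 1
    (fun k _ => ?_)).trans (by simp))
  compute_degree

/-- The polynomial `p(t)[v]`, specialized at `h = lam`. -/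
def specialize (v : Fin n → ℤ) (p : Polynomial (UBar K n)) : Polynomial K :=
  p.map ((evalAt lam hlam).comp (shift v)).toRingHom

@[simp] theorem coeff_specialize (v : Fin n → ℤ) (p : Polynomial (UBar K n)) (k : ℕ) :
    (specialize lam hlam v p).coeff k = evalAt lam hlam (shift v (p.coeff k)) := by
  simp [specialize]

theorem degree_specialize_lt (v : Fin n → ℤ) {p : Polynomial (UBar K n)} (hp : p.degree < n) :
    (specialize lam hlam v p).degree < n :=
  Polynomial.degree_map_le.trans_lt hp

theorem specialize_eDiv (v : Fin n → ℤ) (i : Fin n) :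
    specialize lam hlam v (eDiv i) = eDivAt (fun k => lam k + v k) i := by
  simp [specialize, eDiv, eDivAt, Polynomial.map_prod]

variable {s : Fin n → UBar K n} {ρ : Polynomial (UBar K n)}

/-- One step of the telescoping from ρ to ρ[-ε]. The product form of the correction shows when it
vanishes: when t = -(λₖ + vₖ) for some k ≠ j. -/
theorem eval_reflect_specialize
    (hρ : ∀ j : Fin n, ρ - ρ.map (shift (-Pi.single j 1)).toRingHom =
      eDiv j * Polynomial.C (s j)) (v : Fin n → ℤ) (j : Fin n) (t : K) :
    ((specialize lam hlam v ρ).reflect (n - 1)).eval t =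
      ((specialize lam hlam (v + -Pi.single j 1) ρ).reflect (n - 1)).eval t +
        evalAt lam hlam (shift v (s j)) * ∏ k ∈ Finset.univ.erase j, (t + (lam k + v k)) := by
  have key : specialize lam hlam v ρ = specialize lam hlam (v + -Pi.single j 1) ρ
      + Polynomial.C (evalAt lam hlam (shift v (s j))) * eDivAt (fun k => lam k + v k) j := by
    ext k
    have := congrArg (fun p => evalAt lam hlam (shift v (Polynomial.coeff p k))) (hρ j)
    simp only [Polynomial.coeff_sub, Polynomial.coeff_map, AlgHom.toRingHom_eq_coe,
      RingHom.coe_coe, map_sub, Polynomial.coeff_mul_C, map_mul, shift_shift] at this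
    rw [← specialize_eDiv lam hlam]
    simp only [Polynomial.coeff_add, Polynomial.coeff_C_mul, coeff_specialize]
    linear_combination this
  rw [key, Polynomial.reflect_add, Polynomial.reflect_C_mul, Polynomial.eval_add,
    Polynomial.eval_C_mul, eval_reflect_eDivAt]

/-- Telescoping in an order adapted to the point t = 1 - λᵢ: the shift by -εᵢ comes first and gives
the only correction, since all later ones vanish there. -/
theorem eval_reflect_specialize_sub
    (hρ : ∀ j : Fin n, ρ - ρ.map (shift (-Pi.single j 1)).toRingHom =
      eDiv j * Polynomial.C (s j)) (i : Fin n) :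
    ((specialize lam hlam 0 ρ).reflect (n - 1)).eval (1 - lam i) =
      ((specialize lam hlam (fun _ => -1) ρ).reflect (n - 1)).eval (1 - lam i) +
        evalAt lam hlam (s i) * ∏ k ∈ Finset.univ.erase i, (1 - lam i + lam k) := by
  have step : ∀ S : Finset (Fin n), i ∉ S →
      ((specialize lam hlam (-Pi.single i 1 + ∑ j ∈ S, -Pi.single j 1) ρ).reflect (n - 1)).eval
        (1 - lam i) =
      ((specialize lam hlam (-Pi.single i 1) ρ).reflect (n - 1)).eval (1 - lam i) := by
    intro S hS
    induction S using Finset.induction_on with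
    | empty => simp
    | insert j S hj ih =>
      have hi : i ∉ S := fun hi => hS (Finset.mem_insert_of_mem hi)
      have hij : i ≠ j := fun h0 => hS (h0 ▸ Finset.mem_insert_self _ _)
      rw [← ih hi, eval_reflect_specialize lam hlam hρ (_ + ∑ j ∈ S, _) j, Finset.sum_insert hj,
        add_comm (-Pi.single j 1), ← add_assoc, eq_comm, add_eq_left]
      -- The accumulated shift has i-th component -1, so the factor with index i is (1 - λᵢ) + (λᵢ -
      -- 1) = 0.
      refine mul_eq_zero_of_right _ (Finset.prod_eq_zero
        (Finset.mem_erase.mpr ⟨hij, Finset.mem_univ i⟩) ?_)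
      have : ∑ j ∈ S, (Pi.single j 1 : Fin n → ℤ) i = 0 :=
        Finset.sum_eq_zero fun l hl => Pi.single_eq_of_ne (fun h0 : i = l => hi (h0 ▸ hl)) _
      simp [Finset.sum_apply, this]
      ring
  have total : -Pi.single i 1 + ∑ j ∈ Finset.univ.erase i, -Pi.single j 1
      = (fun _ => -1 : Fin n → ℤ) := by
    rw [Finset.add_sum_erase _ (fun j : Fin n => (-Pi.single j 1 : Fin n → ℤ)) (Finset.mem_univ i)]
    ext k
    simp [Finset.sum_apply, Pi.single_apply]
  have := step (Finset.univ.erase i) (by simp)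
  rw [total] at this
  rw [this, eval_reflect_specialize lam hlam hρ 0 i, zero_add]
  simp [shift_zero]

end Specialization

/-! ### Action on the induced module. -/

section LowestWeight

variable {K : Type*} [Field K] {n : ℕ} {σ : UBar K n} (hσ : σ ∈ W K n) (lam : Fin n → K)
  (hlam : ∀ i j, i ≠ j → ∀ a : ℤ, lam i - lam j ≠ (a : K))

/-- The image of `1 ⊗ m` in the induced module. -/
def Ind.of {A : Type*} [Ring A] [Algebra K A] (B : Subalgebra K A) {M : Type*} [AddCommGroup M]
    [Module K M] [Module B M] (m : M) : Ind B M :=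
  (balancedSubmodule B M).mkQ (1 ⊗ₜ[K] m)

theorem Ind.smul_of {A : Type*} [Ring A] [Algebra K A] (B : Subalgebra K A) {M : Type*}
    [AddCommGroup M] [Module K M] [Module B M] (b : B) (m : M) :
    (b : A) • Ind.of (K := K) B m = Ind.of B (b • m) := by
  rw [Ind.of, Ind.of, ← map_smul, ← sub_eq_zero, ← map_sub, Submodule.mkQ_apply,
    Submodule.Quotient.mk_eq_zero]
  exact Submodule.subset_span ⟨1, b, m, by simp [TensorProduct.smul_tmul']⟩

theorem Ind.of_smul {A : Type*} [Ring A] [Algebra K A] (B : Subalgebra K A) {M : Type*}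
    [AddCommGroup M] [Module K M] [Module B M] (r : K) (m : M) :
    Ind.of (K := K) B (r • m) = r • Ind.of B m := by
  rw [Ind.of, Ind.of, TensorProduct.tmul_smul]
  rfl

/-- An element of the ring that commutes with all others and acts by a scalar on the generating
vectors of an induced module acts by this scalar. -/
theorem Ind.smul_eq_of_central {A : Type*} [Ring A] [Algebra K A] (B : Subalgebra K A) {M : Type*}
    [AddCommGroup M] [Module K M] [Module B M] {c : A} (hc : ∀ a, a * c = c * a) {r : K}
    (hr : ∀ m : M, c • Ind.of (K := K) B m = r • Ind.of B m) (w : Ind (K := K) B M) :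
    c • w = r • w := by
  obtain ⟨w, rfl⟩ := Submodule.mkQ_surjective _ w
  induction w using TensorProduct.induction_on with
  | zero => simp
  | tmul a m =>
    have : (balancedSubmodule B M).mkQ (a ⊗ₜ[K] m) = a • Ind.of (K := K) B m := by
      rw [Ind.of, ← map_smul, TensorProduct.smul_tmul', smul_eq_mul, mul_one]
    rw [this, smul_smul, ← hc, ← smul_smul, hr, smul_comm]
  | add x y hx hy => rw [map_add, smul_add, smul_add, hx, hy]

/-- The character is prescribed only on the `h i`, but a homomorphism on `Ū(n)` is determined by
these values. -/
theorem coef_smul_of (u : UBar K n) (m : LowestLine hσ lam hlam) :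
    DiffRing.coef (fun i => Delta i σ) u • Ind.of (K := K) (DSub σ) m = evalAt lam hlam u • Ind.of (DSub σ) m := by
  have key : (lowestCharacter hσ lam hlam).comp ((DiffRing.coef (fun i => Delta i σ)).codRestrict
      (DSub σ) (fun u => (DSub.coef σ u).2)) = evalAt lam hlam :=
    uBar_hom_ext fun i =>
      ((existsUnique_character hσ lam hlam).choose_spec.1.1 i).trans (evalAt_h _ _ _).symm
  have hu : lowestCharacter hσ lam hlam (DSub.coef σ u) = evalAt lam hlam u :=
    DFunLike.congr_fun key u
  refine (Ind.smul_of (DSub σ) (DSub.coef σ u) m).trans ?_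
  rw [← Ind.of_smul, ← hu]
  rfl

theorem del_smul_of (i : Fin n) (m : LowestLine hσ lam hlam) :
    DiffRing.del (fun i => Delta i σ) i • Ind.of (K := K) (DSub σ) m = 0 := by
  have hi : lowestCharacter hσ lam hlam (DSub.del σ i) = 0 :=
    (existsUnique_character hσ lam hlam).choose_spec.1.2 i
  refine (Ind.smul_of (DSub σ) (DSub.del σ i) m).trans ?_
  have : DSub.del σ i • m = (0 : K) • m := by rw [← hi]; rfl
  rw [this, Ind.of_smul, zero_smul]

/-- Γᵢ commutes with `Ū(n)`, so it preserves the weight `lam`; this makes the relations on the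
vacuum linear equations with scalar coefficients. -/
theorem coef_smul_del_mul_x_smul_of (i : Fin n) (u : UBar K n) (m : LowestLine hσ lam hlam) :
    DiffRing.coef (fun i => Delta i σ) u • (DiffRing.del (fun i => Delta i σ) i * DiffRing.x _ i) •
        Ind.of (K := K) (DSub σ) m =
      evalAt lam hlam u • (DiffRing.del (fun i => Delta i σ) i * DiffRing.x _ i) •
        Ind.of (K := K) (DSub σ) m := by
  rw [smul_smul, DiffRing.coef_mul_del_mul_x, ← smul_smul, coef_smul_of, smul_comm]

/-- The Cauchy system: `x_mul_del_self` is applied to a vector killed by `∂̄ᵢ`. -/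
theorem sum_del_mul_x_smul_of (i : Fin n) (m : LowestLine hσ lam hlam) :
    ∑ k, (lam k - lam i + 1)⁻¹ • (DiffRing.del (fun i => Delta i σ) k * DiffRing.x _ k) •
        Ind.of (K := K) (DSub σ) m =
      evalAt lam hlam (Delta i σ) • Ind.of (DSub σ) m := by
  have key := congrArg (· • Ind.of (K := K) (DSub σ) m)
    (DiffRing.x_mul_del_self (fun i => Delta i σ) i)
  simp only [sub_smul, Finset.sum_smul] at key
  rw [← smul_smul, del_smul_of, smul_zero, eq_comm, sub_eq_zero, coef_smul_of] at key
  rw [← key]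
  refine Finset.sum_congr rfl fun k _ => ?_
  have hu : IsUnit ((h k : UBar K n) - h i + 1) := by
    by_cases hk : k = i
    · simp [hk]
    · simpa using isUnit_h_sub (K := K) k i hk 1
  have := map_inverse_of_isUnit (evalAt lam hlam).toRingHom hu
  rw [← smul_smul (DiffRing.coef _ _), coef_smul_del_mul_x_smul_of]
  congr 1
  simpa using this.symm

/-- It suffices that ∑ⱼ eⱼ(t) Γⱼ and ρ - ρ[-ε] agree on the vacuum; this is interpolated from the
Cauchy system at the points 1 - λᵢ. -/
theorem cCoeff_smul_of {ρ : Polynomial (UBar K n)} (hρdeg : ρ.degree < n)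
    (hρ : ∀ j : Fin n, ρ - ρ.map (shift (-Pi.single j 1)).toRingHom =
      eDiv j * Polynomial.C (Delta j σ)) (k : ℕ) (m : LowestLine hσ lam hlam) :
    DiffRing.cCoeff (fun i => Delta i σ) ρ k • Ind.of (K := K) (DSub σ) m =
      (-evalAt lam hlam (shift (fun _ => -1) (ρ.coeff k))) • Ind.of (DSub σ) m := by
  have hne : ∀ i j, 1 - lam i + lam j ≠ 0 := by
    intro i j h0
    by_cases hij : i = j
    · simp [hij] at h0
    · exact hlam i j hij 1 (by push_cast; linear_combination -h0)
  have hinj : Function.Injective (fun i => 1 - lam i) := by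
    intro i j hij
    by_contra h0
    exact hlam i j h0 0 (by push_cast; linear_combination -hij)
  -- Linear functionals separate the vectors of the induced module, so the interpolation can be done
  -- with polynomials over `K`.
  rw [← sub_eq_zero, ← Module.forall_dual_apply_eq_zero_iff K]
  intro φ
  let Γ : Fin n → K := fun j => φ ((DiffRing.del (fun i => Delta i σ) j * DiffRing.x _ j) •
        Ind.of (K := K) (DSub σ) m)
  let a : K := φ (Ind.of (DSub σ) m)
  have cauchy : ∀ i, ∑ j, (lam j - lam i + 1)⁻¹ * Γ j = evalAt lam hlam (Delta i σ) * a := by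
    intro i
    simpa using congrArg φ (sum_del_mul_x_smul_of hσ lam hlam i m)
  have key : ∑ j, Polynomial.C (Γ j) * eDivAt lam j
        + Polynomial.C a * specialize lam hlam (fun _ => -1) ρ
      = Polynomial.C a * specialize lam hlam 0 ρ := by
    have deg : ∀ (b : K) {p : Polynomial K}, p.degree < n → (Polynomial.C b * p).degree < n := by
      intro b p hp
      rw [← Polynomial.smul_eq_C_mul]
      exact (Polynomial.degree_smul_le _ _).trans_lt hp
    refine eq_of_eval_reflect_eq ?_ (deg _ (degree_specialize_lt _ _ _ hρdeg)) hinj fun i => ?_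
    · rw [← Polynomial.mem_degreeLT]
      refine Submodule.add_mem _ (Submodule.sum_mem _ fun j _ => ?_) ?_
      · exact Polynomial.mem_degreeLT.mpr (deg _ (degree_eDivAt_lt _ _))
      · exact Polynomial.mem_degreeLT.mpr (deg _ (degree_specialize_lt _ _ _ hρdeg))
    · have hsum : ((∑ j, Polynomial.C (Γ j) * eDivAt lam j).reflect (n - 1)).eval (1 - lam i)
          = ∑ j, Γ j * ∏ k ∈ Finset.univ.erase j, (1 - lam i + lam k) := by
        simp only [reflect_sum, Polynomial.eval_finsetSum, Polynomial.reflect_C_mul,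
          Polynomial.eval_C_mul, eval_reflect_eDivAt]
      -- Division by the factor with index j produces the entries of the Cauchy system. At j = i
      -- that factor is 1, so the product over k ≠ i in the ρ-correction is the full product.
      have hprod : ∀ j, ∏ k ∈ Finset.univ.erase j, (1 - lam i + lam k)
          = (∏ k, (1 - lam i + lam k)) * (lam j - lam i + 1)⁻¹ := by
        intro j
        rw [← Finset.mul_prod_erase Finset.univ _ (Finset.mem_univ j)]
        have := hne i j
        rw [show lam j - lam i + 1 = 1 - lam i + lam j by ring]
        field_simp
      rw [Polynomial.reflect_add, Polynomial.reflect_C_mul, Polynomial.reflect_C_mul,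
        Polynomial.eval_add, Polynomial.eval_C_mul, Polynomial.eval_C_mul, hsum,
        eval_reflect_specialize_sub lam hlam hρ i, hprod i, sub_self, zero_add, inv_one, mul_one,
        mul_add, ← mul_assoc a, mul_comm a (evalAt _ _ _), ← cauchy i, Finset.sum_mul, add_comm]
      congr 1
      refine Finset.sum_congr rfl fun j _ => ?_
      rw [hprod]
      ring
  have := congrArg (Polynomial.coeff · k) key
  simp only [Polynomial.coeff_add, Polynomial.finsetSum_coeff, Polynomial.coeff_C_mul,
    coeff_specialize, shift_zero] at this
  have he : ∀ j, (eDivAt lam j).coeff k = evalAt lam hlam ((eDiv j).coeff k) := by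
    intro j
    have := congrArg (Polynomial.coeff · k) (specialize_eDiv lam hlam 0 j)
    simpa [shift_zero] using this.symm
  have hc : φ (DiffRing.cCoeff (fun i => Delta i σ) ρ k • Ind.of (K := K) (DSub σ) m) =
      ∑ j, Γ j * (eDivAt lam j).coeff k - a * evalAt lam hlam (ρ.coeff k) := by
    rw [DiffRing.cCoeff, sub_smul, Finset.sum_smul, map_sub, map_sum, coef_smul_of, map_smul,
      smul_eq_mul, mul_comm _ a]
    congr 1
    refine Finset.sum_congr rfl fun j _ => ?_
    rw [← smul_smul (DiffRing.coef _ _), coef_smul_del_mul_x_smul_of, map_smul, smul_eq_mul, he, mul_comm]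
  rw [map_sub, hc, map_smul, smul_eq_mul]
  linear_combination this

theorem coeff_cPoly (σ : UBar K n) (ρ : Polynomial (UBar K n)) (k : ℕ) :
    (cPoly σ ρ).coeff k = DiffRing.cCoeff (fun i => Delta i σ) ρ k := by
  simp [cPoly, DiffRing.cCoeff, Polynomial.finsetSum_coeff, -map_mul]

end LowestWeight

end HDeformed

end

/-- The central polynomial `c(t)` acts on the lowest weight representation of lowest weight `lam`
as multiplication by the scalar polynomial `-ρ(t)[-ε]`, `ε = ε₁ + ⋯ + εₙ`, evaluated at
`h i = lam i`. -/
theorem proposition3p10 {K : Type*} [Field K] [CharZero K] (n : ℕ)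
    (σ : HDeformed.UBar K n) (hσ : σ ∈ HDeformed.W K n)
    (ρ : Polynomial (HDeformed.UBar K n)) (hρdeg : ρ.degree < n)
    (hρ : ∀ j : Fin n, ρ - ρ.map (HDeformed.shift (-Pi.single j 1)).toRingHom =
      HDeformed.eDiv j * Polynomial.C (HDeformed.Delta j σ))
    (lam : Fin n → K) (hlam : ∀ i j, i ≠ j → ∀ a : ℤ, lam i - lam j ≠ (a : K))
    (k : ℕ) (w : HDeformed.LowestWeightRep hσ lam hlam) :
    (HDeformed.cPoly σ ρ).coeff k • w =
      (-HDeformed.evalAt lam hlam (HDeformed.shift (fun _ => -1) (ρ.coeff k))) • w := by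
  rw [HDeformed.coeff_cPoly]
  exact HDeformed.Ind.smul_eq_of_central _ (HDeformed.DiffRing.mul_cCoeff hρ k)
    (HDeformed.cCoeff_smul_of hσ lam hlam hρdeg hρ k) w
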